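/- Let $r\in\{\infty,\omega\}$, let $M$ be a paracompact Hausdorff $C^r$ manifold (finite-dimensional, without boundary), and let $f,g_1,\dots,g_m$ be $C^r$ vector fields on $M$, defining the affine control system $\Sigma:\ \dot x=f(x)+\sum_{i=1}^m g_i(x)u_i$. Let $D$ be an involutive regular $C^r$ distribution on $M$: each $D_q$ is a linear subspace of $T_qM$, the dimension of $D_q$ is locally constant in $q$, around every point $D$ is spanned pointwise by $C^r$ vector fields, and the bracket of two local $C^r$ sections of $D$ is again a section of $D$. For $U\subseteq M$ open let $C^r(U)$ be the ring of real $C^r$ functions on $U$, let $\Gamma^r(U;D)$ be the $C^r(U)$-module of $C^r$ sections of $D$ over $U$, and let $\operatorname{span}_{C^r(U)}\{g_1,\dots,g_m\}$ be the $C^r(U)$-module of vector fields on $U$ spanned by $g_1|_U,\dots,g_m|_U$. A small neighbourhood of a point $p\in M$ means an open set $U\ni p$ such that every vector of $D_p$ is the value at $p$ of some section in $\Gamma^r(U;D)$. (There is a neighbourhood $W$ of $p$ such that all open $U$ with $p\in U\subseteq W$ have this property; if $r=\infty$, all open $U\ni p$ have it.) The distribution $D$ is called locally controlled invariant for $\Sigma$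 at $p$ if there are a small neighbourhood $U$ of $p$ and $C^r$ feedback functions $\alpha=(\alpha_i):U\to\mathbb R^m$, $\beta=(\beta_{ij}):U\to GL(m,\mathbb R)$ such that, with $\hat f=f+\sum_{i}\alpha_i g_i$ and $\hat g_i=\sum_{j}\beta_{ij}g_j$, $$[\hat f,\Gamma^r(U;D)]\subseteq\Gamma^r(U;D),\qquad [\hat g_i,\Gamma^r(U;D)]\subseteq\Gamma^r(U;D),\quad i=1,\dots,m.$$ Theorem. Let $p\in M$. Then $D$ is locally controlled invariant for $\Sigma$ at $p$ if and only if there is a small neighbourhood $U$ of $p$ such that $$[g_i,\Gamma^r(U;D)]\subseteq\Gamma^r(U;D)+\operatorname{span}_{C^r(U)}\{g_1,\dots,g_m\},\quad i=1,\dots,m,$$ $$[f,\Gamma^r(U;D)]\subseteq\Gamma^r(U;D)+\operatorname{span}_{C^r(U)}\{g_1,\dots,g_m\}.$$ No constant-rank assumption is made on $\operatorname{span}_{\mathbb R}\{g_1(q),\dots,g_m(q)\}$, on its sum with $D_q$ or on its intersection with $D_q$. -/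

import Mathlib

open scoped Manifold ContDiff Topology

namespace ControlledInvariance

variable {E : Type*} [NormedAddCommGroup E] [NormedSpace ℝ E]
  {M : Type*} [TopologicalSpace M] [ChartedSpace E M]

/-- A (not necessarily continuous) vector field on `M`. A vector field on an open subset `U` is
represented by any extension of it to `M`; all the notions below only look at values on `U`. -/
abbrev VField (E : Type*) [NormedAddCommGroup E] [NormedSpace ℝ E]
    (M : Type*) [TopologicalSpace M] [ChartedSpace E M] : Type _ :=
  (x : M) → TangentSpace 𝓘(ℝ, E) x

/-- A generalized distribution of `M`: a linear subspace of each tangent space. -/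
abbrev GenDistribution (E : Type*) [NormedAddCommGroup E] [NormedSpace ℝ E]
    (M : Type*) [TopologicalSpace M] [ChartedSpace E M] : Type _ :=
  (x : M) → Submodule ℝ (TangentSpace 𝓘(ℝ, E) x)

/-- The vector field `X` is of class `C^r` on `U`. -/
def IsCrOn [IsManifold 𝓘(ℝ, E) 1 M] (r : ℕ∞ω) (U : Set M) (X : VField E M) : Prop :=
  ContMDiffOn 𝓘(ℝ, E) (𝓘(ℝ, E)).tangent r
    (fun x ↦ (⟨x, X x⟩ : TangentBundle 𝓘(ℝ, E) M)) U

/-- `Γ^r(U; D)`: the `C^r` sections of `D` over `U`. -/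
def sections [IsManifold 𝓘(ℝ, E) 1 M] (r : ℕ∞ω) (U : Set M) (D : GenDistribution E M) :
    Set (VField E M) :=
  {X | IsCrOn r U X ∧ ∀ q ∈ U, X q ∈ D q}

/-- `C^r(U)`: the real functions of class `C^r` on `U`. -/
def functions (E : Type*) [NormedAddCommGroup E] [NormedSpace ℝ E]
    {M : Type*} [TopologicalSpace M] [ChartedSpace E M] (r : ℕ∞ω) (U : Set M) : Set (M → ℝ) :=
  {φ | ContMDiffOn 𝓘(ℝ, E) 𝓘(ℝ, ℝ) r φ U}

/-- `Γ^r(U; D) + span_{C^r(U)} {g_1, …, g_m}`. -/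
def sectionsAddSpan [IsManifold 𝓘(ℝ, E) 1 M] (r : ℕ∞ω) (U : Set M) (D : GenDistribution E M)
    {m : ℕ} (g : Fin m → VField E M) : Set (VField E M) :=
  {Z | ∃ Y ∈ sections r U D, ∃ c : Fin m → M → ℝ, (∀ j, c j ∈ functions E r U) ∧
    ∀ q ∈ U, Z q = Y q + ∑ j, c j q • g j q}

/-- `D` is a regular `C^r` distribution: around each point it is spanned by a family of `C^r`
vector fields, and its rank is locally constant. -/
structure IsRegularDistribution [IsManifold 𝓘(ℝ, E) 1 M] (r : ℕ∞ω)
    (D : GenDistribution E M) : Prop where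
  exists_generators : ∀ p : M, ∃ U : Set M, IsOpen U ∧ p ∈ U ∧ ∃ S : Set (VField E M),
    (∀ X ∈ S, IsCrOn r U X) ∧ ∀ q ∈ U, D q = Submodule.span ℝ ((fun X : VField E M ↦ X q) '' S)
  rank_locally_constant : ∀ p : M, ∀ᶠ q in 𝓝 p, Module.finrank ℝ (D q) = Module.finrank ℝ (D p)

/-- `D` is involutive: brackets of local `C^r` sections of `D` are sections of `D`. -/
def IsInvolutive [IsManifold 𝓘(ℝ, E) 1 M] (r : ℕ∞ω) (D : GenDistribution E M) : Prop :=
  ∀ U : Set M, IsOpen U → ∀ X ∈ sections r U D, ∀ Y ∈ sections r U D,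
    VectorField.mlieBracket 𝓘(ℝ, E) X Y ∈ sections r U D

/-- The affine control system `ẋ = f(x) + ∑ i, u i • g i (x)` with `C^r` vector fields
`f, g_1, …, g_m` on `M`. -/
structure AffineSystem (E : Type*) [NormedAddCommGroup E] [NormedSpace ℝ E]
    (M : Type*) [TopologicalSpace M] [ChartedSpace E M] [IsManifold 𝓘(ℝ, E) 1 M]
    (r : ℕ∞ω) (m : ℕ) where
  f : VField E M
  g : Fin m → VField E M
  f_cr : IsCrOn r Set.univ f
  g_cr : ∀ i, IsCrOn r Set.univ (g i)

/-- `C^r` feedback functions on `U`: `α : U → ℝ^m` and `β : U → GL(m, ℝ)`. -/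
structure IsFeedback (E : Type*) [NormedAddCommGroup E] [NormedSpace ℝ E]
    {M : Type*} [TopologicalSpace M] [ChartedSpace E M] (r : ℕ∞ω) (U : Set M) {m : ℕ}
    (α : M → Fin m → ℝ) (β : M → Matrix (Fin m) (Fin m) ℝ) : Prop where
  alpha_cr : ∀ i, (fun q ↦ α q i) ∈ functions E r U
  beta_cr : ∀ i j, (fun q ↦ β q i j) ∈ functions E r U
  beta_invertible : ∀ q ∈ U, IsUnit (β q)

/-- The drift `f + ∑ i, α_i g_i` of the system obtained by feedback. -/
noncomputable def AffineSystem.feedbackDrift [IsManifold 𝓘(ℝ, E) 1 M] {r : ℕ∞ω} {m : ℕ}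
    (S : AffineSystem E M r m) (α : M → Fin m → ℝ) : VField E M :=
  fun q ↦ S.f q + ∑ i, α q i • S.g i q

/-- The control vector field `∑ j, β_ij g_j` of the system obtained by feedback. -/
noncomputable def AffineSystem.feedbackControl [IsManifold 𝓘(ℝ, E) 1 M] {r : ℕ∞ω} {m : ℕ}
    (S : AffineSystem E M r m) (β : M → Matrix (Fin m) (Fin m) ℝ) (i : Fin m) : VField E M :=
  fun q ↦ ∑ j, β q i j • S.g j q

/-- `U` is an open neighbourhood of `p`, so small that each vector of `D p` is the value at `p` of
a section in `Γ^r(U; D)`. Every open neighbourhood of `p` inside a suitable one is of this kind,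
see `exists_isSmallNhd`. For `r = ∞` every open neighbourhood qualifies, see
`isSmallNhd_of_smooth`; for `r = ω` on a paracompact Hausdorff manifold the same follows from
Cartan's Theorem A. -/
structure IsSmallNhd [IsManifold 𝓘(ℝ, E) 1 M] (r : ℕ∞ω) (D : GenDistribution E M) (p : M)
    (U : Set M) : Prop where
  isOpen : IsOpen U
  mem : p ∈ U
  exists_section : ∀ v ∈ D p, ∃ X ∈ sections r U D, X p = v

/-- `D` is locally controlled invariant for the system `S` at `p`. -/
def IsLocallyControlledInvariantAt [IsManifold 𝓘(ℝ, E) 1 M] {r : ℕ∞ω} {m : ℕ}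
    (D : GenDistribution E M) (S : AffineSystem E M r m) (p : M) : Prop :=
  ∃ U : Set M, IsSmallNhd r D p U ∧
    ∃ (α : M → Fin m → ℝ) (β : M → Matrix (Fin m) (Fin m) ℝ), IsFeedback E r U α β ∧
      (∀ X ∈ sections r U D,
        VectorField.mlieBracket 𝓘(ℝ, E) (S.feedbackDrift α) X ∈ sections r U D) ∧
      ∀ i, ∀ X ∈ sections r U D,
        VectorField.mlieBracket 𝓘(ℝ, E) (S.feedbackControl β i) X ∈ sections r U D

/-- All sufficiently small open neighbourhoods of `p` satisfy `IsSmallNhd`. -/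
theorem exists_isSmallNhd {r : ℕ∞ω} (hr : r = ∞ ∨ r = ω) [IsManifold 𝓘(ℝ, E) ∞ M]
    [IsManifold 𝓘(ℝ, E) r M] {D : GenDistribution E M}
    (hD : IsRegularDistribution r D) (p : M) :
    ∃ W ∈ 𝓝 p, ∀ U ⊆ W, IsOpen U → p ∈ U → IsSmallNhd r D p U := by
  have hb : ContMDiffVectorBundle r E (TangentSpace 𝓘(ℝ, E) : M → Type _) 𝓘(ℝ, E) := by
    rcases hr with rfl | rfl <;> infer_instance
  obtain ⟨W, hW, hpW, S, hS, hDS⟩ := hD.exists_generators p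
  refine ⟨W, hW.mem_nhds hpW, fun U hUW hU hp ↦ ⟨hU, hp, fun v hv ↦ ?_⟩⟩
  rw [hDS p hpW] at hv
  induction hv using Submodule.span_induction with
  | mem v hv =>
    obtain ⟨X, hX, rfl⟩ := hv
    refine ⟨X, ⟨(hS X hX).mono hUW, fun q hq ↦ ?_⟩, rfl⟩
    rw [hDS q (hUW hq)]
    exact Submodule.subset_span ⟨X, hX, rfl⟩
  | zero =>
    exact ⟨fun _ ↦ 0, ⟨(Bundle.contMDiff_zeroSection ℝ
      (TangentSpace 𝓘(ℝ, E) : M → Type _)).contMDiffOn, fun q _ ↦ (D q).zero_mem⟩, rfl⟩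
  | add v w _ _ hv hw =>
    obtain ⟨X, hX, rfl⟩ := hv
    obtain ⟨Y, hY, rfl⟩ := hw
    exact ⟨fun q ↦ X q + Y q, ⟨ContMDiffOn.add_section hX.1 hY.1,
      fun q hq ↦ (D q).add_mem (hX.2 q hq) (hY.2 q hq)⟩, rfl⟩
  | smul a v _ hv =>
    obtain ⟨X, hX, rfl⟩ := hv
    exact ⟨fun q ↦ a • X q, ⟨ContMDiffOn.const_smul_section hX.1,
      fun q hq ↦ (D q).smul_mem a (hX.2 q hq)⟩, rfl⟩

/-- For `r = ∞` every open neighbourhood of `p` satisfies `IsSmallNhd`. -/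
theorem isSmallNhd_of_smooth [FiniteDimensional ℝ E] [T2Space M] [IsManifold 𝓘(ℝ, E) ∞ M]
    {D : GenDistribution E M} (hD : IsRegularDistribution ∞ D) {p : M} {U : Set M}
    (hU : IsOpen U) (hp : p ∈ U) : IsSmallNhd ∞ D p U := by
  refine ⟨hU, hp, fun v hv ↦ ?_⟩
  obtain ⟨W, hW, h⟩ := exists_isSmallNhd (Or.inl rfl) hD p
  obtain ⟨V, hVW, hV, hpV⟩ := mem_nhds_iff.1 hW
  obtain ⟨X, hX, rfl⟩ := (h V hVW hV hpV).exists_section v hv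
  obtain ⟨φ, -, hφ⟩ := (SmoothBumpFunction.nhds_basis_tsupport (I := 𝓘(ℝ, E)) p).mem_iff.1
    (hV.mem_nhds hpV)
  refine ⟨fun q ↦ φ q • X q, ⟨?_, fun q _ ↦ ?_⟩, by simp⟩
  · exact (ContMDiffOn.smul_section_of_tsupport φ.contMDiff.contMDiffOn hV hφ hX.1).contMDiffOn
  · by_cases hq : q ∈ V
    · exact (D q).smul_mem _ (hX.2 q hq)
    · have : φ q = 0 := image_eq_zero_of_notMem_tsupport fun h ↦ hq (hφ h)
      simp [this]

end ControlledInvariance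

open ControlledInvariance

/-!
That the bracket conditions are necessary is the Leibniz rule: `g` is recovered from the new
control fields by means of `β⁻¹`, and then `f` from the new drift (`mlieBracket_g_mem`,
`mlieBracket_f_mem`).

For the converse, Frobenius' theorem provides coordinates `θ = (x, y)` near `p` in which `D` is
the kernel of `dy` (`exists_adapted_coordinates`). For a vector field `Z` let `Z^c` be its
transverse components, the derivatives of the coordinates `y_c` along `Z`. By the commutator
formula, `Z` leaves `D` invariant exactly when all the `Z^c` are independent of `x`. The bracket
conditions say that for each `c` the vector `n^c = (f^c, g_1^c, …, g_m^c)` satisfies one and the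
same linear equation `∂n/∂v = -C(v) n` in the leaf directions `v`, where `C` is made of the
coefficients occurring in the conditions (`eventually_fderiv_transverse`).

Under assumptions of constant rank the coefficients can be chosen so that `C` is flat, and the
equation can be integrated. In general the coefficients are not unique and `C` has curvature, but
flatness is not needed. Solve the equation `B' = B C`, `B = 1` at `x = 0`, along the rays `t ↦ (t
x, y)` only. Then `B n` is constant along each ray for every actual solution `n`, so `B n` depends
on `y` alone (`exists_radial_gauge`). Hence all the `B n^c` are independent of `x`. As the image
of `C` on `(1, 0)` is zero, `B` fixes `(1, 0)`, and the remaining columns of `B` are feedback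
functions `α`, `β`, with `β(p) = 1`.

Both uses of differential equations, the gauge and Frobenius' theorem, are about equations `γ' =
h(t x, γ) x` along rays, and `C^r` dependence on the data is needed for `r = ∞` and `r = ω` alike.
`exists_radial_solution` gets it from the implicit function theorem in the space of continuous
paths, where the composition operator of a `C^r` map is `C^r`: for `r = ω` its power series at a
constant path is the one of the map, applied pointwise (`eventually_contDiffAt_pathComp`). In
Frobenius' theorem, integrability implies that the radial solution solves the whole total
differential equation, because its defect satisfies a linear equation along rays
(`exists_total_solution`).
-/

namespace ControlledInvariance

universe u

/-! ### The composition operator on spaces of continuous paths -/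

section PathComp

open Classical in
/-- The composition (Nemytskii) operator `γ ↦ h ∘ γ` on continuous maps from a compact space. It
takes the junk value `0` where `h ∘ γ` is not continuous, so that it is defined for every `h`. -/
noncomputable def pathComp {K E F : Type*} [TopologicalSpace K] [TopologicalSpace E]
    [TopologicalSpace F] [Zero F] (h : E → F) (γ : C(K, E)) : C(K, F) :=
  if H : Continuous (h ∘ γ) then ⟨h ∘ γ, H⟩ else 0

theorem pathComp_apply {K E F : Type*} [TopologicalSpace K] [TopologicalSpace E]
    [TopologicalSpace F] [Zero F] {h : E → F} {γ : C(K, E)} (H : Continuous (h ∘ γ)) (t : K) :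
    pathComp h γ t = h (γ t) := by
  simp [pathComp, H]

theorem continuous_comp_path {K E F : Type*} [TopologicalSpace K] [TopologicalSpace E]
    [TopologicalSpace F] {h : E → F} {Ω : Set E} (hh : ContinuousOn h Ω) {γ : C(K, E)}
    (hγ : ∀ t, γ t ∈ Ω) : Continuous (h ∘ γ) :=
  hh.comp_continuous γ.continuous hγ

variable {K : Type*} [TopologicalSpace K] [CompactSpace K]

/-- A continuous bilinear map acts pointwise on continuous maps. -/
noncomputable def pathBilin {E F G : Type*} [NormedAddCommGroup E] [NormedSpace ℝ E]
    [NormedAddCommGroup F] [NormedSpace ℝ F] [NormedAddCommGroup G] [NormedSpace ℝ G]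
    (B : E →L[ℝ] F →L[ℝ] G) : C(K, E) →L[ℝ] C(K, F) →L[ℝ] C(K, G) :=
  LinearMap.mkContinuous₂
    (LinearMap.mk₂ ℝ (fun (η : C(K, E)) (γ : C(K, F)) ↦
        (⟨fun t ↦ B (η t) (γ t), by fun_prop⟩ : C(K, G)))
      (fun _ _ _ ↦ by ext; simp) (fun _ _ _ ↦ by ext; simp)
      (fun _ _ _ ↦ by ext; simp) (fun _ _ _ ↦ by ext; simp)) ‖B‖ fun η γ ↦ by
    refine (ContinuousMap.norm_le _ (by positivity)).2 fun t ↦ ?_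
    refine (B.le_opNorm₂ _ _).trans ?_
    gcongr
    · exact η.norm_coe_le_norm t
    · exact γ.norm_coe_le_norm t

@[simp]
theorem pathBilin_apply {E F G : Type*} [NormedAddCommGroup E] [NormedSpace ℝ E]
    [NormedAddCommGroup F] [NormedSpace ℝ F] [NormedAddCommGroup G] [NormedSpace ℝ G]
    (B : E →L[ℝ] F →L[ℝ] G) (η : C(K, E)) (γ : C(K, F)) (t : K) :
    pathBilin B η γ t = B (η t) (γ t) := rfl

/-- Pointwise application of a path of linear maps. -/
noncomputable abbrev pathApply (E F : Type*) [NormedAddCommGroup E] [NormedSpace ℝ E]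
    [NormedAddCommGroup F] [NormedSpace ℝ F] :
    C(K, E →L[ℝ] F) →L[ℝ] C(K, E) →L[ℝ] C(K, F) :=
  pathBilin (ContinuousLinearMap.id ℝ (E →L[ℝ] F))

theorem isOpen_setOf_forall_mem {E : Type*} [TopologicalSpace E] {Ω : Set E} (hΩ : IsOpen Ω) :
    IsOpen {γ : C(K, E) | ∀ t, γ t ∈ Ω} := by
  have := ContinuousMap.isOpen_setOfPred_mapsTo (X := K) (Y := E) isCompact_univ hΩ
  simpa [Set.MapsTo] using this

/-- Along a path, a map that is continuous near the path is uniformly continuous. -/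
theorem exists_forall_dist_lt_along {E F : Type*} [PseudoMetricSpace E] [PseudoMetricSpace F]
    {h : E → F} {Ω : Set E} (hΩ : IsOpen Ω) (hh : ContinuousOn h Ω) {γ : C(K, E)}
    (hγ : ∀ t, γ t ∈ Ω) {ε : ℝ} (hε : 0 < ε) :
    ∃ δ > 0, ∀ t, ∀ z, dist z (γ t) < δ → z ∈ Ω ∧ dist (h z) (h (γ t)) < ε := by
  have hc : IsCompact (Set.range γ) := isCompact_range γ.continuous
  obtain ⟨δ₁, hδ₁, h₁⟩ := hc.exists_thickening_subset_open hΩ (Set.range_subset_iff.2 hγ)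
  have h₂ := hc.uniformContinuousAt_of_continuousAt h
    (by rintro _ ⟨t, rfl⟩; exact hh.continuousAt (hΩ.mem_nhds (hγ t)))
    (Metric.dist_mem_uniformity hε)
  obtain ⟨δ₂, hδ₂, h₂⟩ := Metric.mem_uniformity_dist.1 h₂
  refine ⟨min δ₁ δ₂, lt_min hδ₁ hδ₂, fun t z hz ↦ ⟨h₁ ?_, ?_⟩⟩
  · exact Metric.mem_thickening_iff.2 ⟨γ t, ⟨t, rfl⟩, hz.trans_le (min_le_left _ _)⟩
  · have := h₂ (a := γ t) (b := z) (by rw [dist_comm]; exact hz.trans_le (min_le_right _ _)) ⟨t, rfl⟩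
    rw [dist_comm]
    exact this

theorem continuousOn_pathComp {E F : Type*} [PseudoMetricSpace E] [NormedAddCommGroup F]
    {h : E → F} {Ω : Set E} (hΩ : IsOpen Ω) (hh : ContinuousOn h Ω) :
    ContinuousOn (pathComp h) {γ : C(K, E) | ∀ t, γ t ∈ Ω} := by
  intro γ hγ
  refine ContinuousAt.continuousWithinAt (Metric.continuousAt_iff.2 fun ε hε ↦ ?_)
  obtain ⟨δ, hδ, H⟩ := exists_forall_dist_lt_along hΩ hh hγ (half_pos hε)
  refine ⟨δ, hδ, fun η hη ↦ ?_⟩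
  have h₁ : ∀ t, dist (η t) (γ t) < δ := fun t ↦ (ContinuousMap.dist_apply_le_dist t).trans_lt hη
  refine ((ContinuousMap.dist_le (half_pos hε).le).2 fun t ↦ ?_).trans_lt (half_lt_self hε)
  rw [pathComp_apply (continuous_comp_path hh fun t ↦ (H t _ (h₁ t)).1),
    pathComp_apply (continuous_comp_path hh hγ)]
  exact (H t _ (h₁ t)).2.le

theorem hasFDerivAt_pathComp {E F : Type*} [NormedAddCommGroup E] [NormedSpace ℝ E]
    [NormedAddCommGroup F] [NormedSpace ℝ F] {h : E → F} {Ω : Set E} (hΩ : IsOpen Ω)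
    (hd : DifferentiableOn ℝ h Ω) (hc : ContinuousOn (fderiv ℝ h) Ω) {γ : C(K, E)}
    (hγ : ∀ t, γ t ∈ Ω) :
    HasFDerivAt (pathComp h) (pathApply E F (pathComp (fderiv ℝ h) γ)) γ := by
  rw [hasFDerivAt_iff_isLittleO, Asymptotics.isLittleO_iff]
  intro ε hε
  obtain ⟨δ, hδ, H⟩ := exists_forall_dist_lt_along hΩ hc hγ hε
  filter_upwards [Metric.ball_mem_nhds γ hδ] with η hη
  have h₁ : ∀ t, dist (η t) (γ t) < δ := fun t ↦ (ContinuousMap.dist_apply_le_dist t).trans_lt hη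
  refine (ContinuousMap.norm_le _ (by positivity)).2 fun t ↦ ?_
  rw [ContinuousMap.sub_apply, ContinuousMap.sub_apply, pathBilin_apply,
    pathComp_apply (continuous_comp_path hd.continuousOn fun t ↦ (H t _ (h₁ t)).1),
    pathComp_apply (continuous_comp_path hd.continuousOn hγ),
    pathComp_apply (continuous_comp_path hc hγ)]
  have := (convex_ball (γ t) δ).norm_image_sub_le_of_norm_hasFDerivWithin_le'
    (f := h) (f' := fderiv ℝ h) (φ := fderiv ℝ h (γ t)) (C := ε) (x := γ t) (y := η t)
    (fun z hz ↦ ((hd z (H t z hz).1).differentiableAt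
      (hΩ.mem_nhds (H t z hz).1)).hasFDerivAt.hasFDerivWithinAt)
    (fun z hz ↦ by rw [← dist_eq_norm]; exact (H t z hz).2.le) (Metric.mem_ball_self hδ) (h₁ t)
  refine this.trans ?_
  gcongr
  exact (η - γ).norm_coe_le_norm t

theorem contDiffOn_pathComp {E : Type u} [NormedAddCommGroup E] [NormedSpace ℝ E] {Ω : Set E}
    (hΩ : IsOpen Ω) (n : ℕ) : ∀ {F : Type u} [NormedAddCommGroup F] [NormedSpace ℝ F] {h : E → F},
      ContDiffOn ℝ n h Ω → ContDiffOn ℝ n (pathComp h) {γ : C(K, E) | ∀ t, γ t ∈ Ω} := by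
  induction n with
  | zero =>
    intro F _ _ h hh
    exact contDiffOn_zero.2 (continuousOn_pathComp hΩ (contDiffOn_zero.1 hh))
  | succ n ih =>
    intro F _ _ h hh
    push_cast at hh ⊢
    obtain ⟨hd, -, hf⟩ := (contDiffOn_succ_iff_fderiv_of_isOpen hΩ).1 hh
    have hD : ∀ γ : C(K, E), (∀ t, γ t ∈ Ω) → HasFDerivAt (pathComp h)
        (pathApply E F (pathComp (fderiv ℝ h) γ)) γ :=
      fun γ hγ ↦ hasFDerivAt_pathComp hΩ hd hf.continuousOn hγ
    refine (contDiffOn_succ_iff_fderiv_of_isOpen (isOpen_setOf_forall_mem hΩ)).2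
      ⟨fun γ hγ ↦ (hD γ hγ).differentiableAt.differentiableWithinAt, fun h ↦ ?_, ?_⟩
    · exact absurd h (by simp)
    · refine ((pathApply E F).contDiff.comp_contDiffOn (ih hf)).congr fun γ hγ ↦ ?_
      exact (hD γ hγ).fderiv

/-- Pointwise evaluation of a continuous multilinear map along paths. -/
noncomputable def pathMultilinear {E F : Type*} [NormedAddCommGroup E] [NormedSpace ℝ E]
    [NormedAddCommGroup F] [NormedSpace ℝ F] {n : ℕ}
    (p : ContinuousMultilinearMap ℝ (fun _ : Fin n ↦ E) F) :
    ContinuousMultilinearMap ℝ (fun _ : Fin n ↦ C(K, E)) C(K, F) :=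
  MultilinearMap.mkContinuous
    { toFun := fun m ↦ ⟨fun t ↦ p fun i ↦ m i t, p.cont.comp (by fun_prop)⟩
      map_update_add' := by
        intro _ m i x y
        ext t
        have e (w : C(K, E)) : (fun j ↦ Function.update m i w j t) =
            Function.update (fun j ↦ m j t) i (w t) :=
          funext fun j ↦ Function.apply_update (fun _ (γ : C(K, E)) ↦ γ t) m i w j
        simp [e]
      map_update_smul' := by
        intro _ m i c x
        ext t
        have e (w : C(K, E)) : (fun j ↦ Function.update m i w j t) =
            Function.update (fun j ↦ m j t) i (w t) :=
          funext fun j ↦ Function.apply_update (fun _ (γ : C(K, E)) ↦ γ t) m i w j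
        simp [e] }
    ‖p‖ fun m ↦ (ContinuousMap.norm_le _ (by positivity)).2 fun t ↦
      (p.le_opNorm _).trans (by gcongr with i; exact (m i).norm_coe_le_norm t)

/-- The power series of `h` at `z`, applied pointwise, is a power series of the composition operator
at the constant path `z`, with at least the same radius of convergence. -/
theorem analyticAt_pathComp_const {E F : Type*} [NormedAddCommGroup E] [NormedSpace ℝ E]
    [NormedAddCommGroup F] [NormedSpace ℝ F] [CompleteSpace F] {h : E → F} {z : E}
    (hh : AnalyticAt ℝ h z) :
    AnalyticAt ℝ (pathComp h) (ContinuousMap.const K z) := by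
  obtain ⟨p, ρ, hp⟩ := hh
  let q : FormalMultilinearSeries ℝ C(K, E) C(K, F) := fun n ↦ pathMultilinear (p n)
  have hq : p.radius ≤ q.radius := FormalMultilinearSeries.radius_le_of_le fun n ↦
    MultilinearMap.mkContinuous_norm_le _ (norm_nonneg _) _
  refine ⟨q, ρ, ⟨hp.r_le.trans hq, hp.r_pos, fun {y} hy ↦ ?_⟩⟩
  have hs := q.hasSum (Metric.eball_subset_eball (hp.r_le.trans hq) hy)
  have key : ∀ t, q.sum y t = h (z + y t) := fun t ↦ by
    refine ((ContinuousMap.evalCLM ℝ t).hasSum hs).unique (hp.hasSum (y := y t) ?_)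
    rw [Metric.mem_eball, edist_zero_right] at hy ⊢
    refine lt_of_le_of_lt ?_ hy
    rw [← ofReal_norm, ← ofReal_norm]
    exact ENNReal.ofReal_le_ofReal (y.norm_coe_le_norm t)
  have : q.sum y = pathComp h (ContinuousMap.const K z + y) := by
    have hc : h ∘ (ContinuousMap.const K z + y : C(K, E)) = q.sum y := by
      ext t; simp [key]
    ext t
    rw [pathComp_apply (by rw [hc]; exact (q.sum y).continuous), key]
    simp
  rwa [this] at hs

/-- The composition operator of a map that is `C^r` near `z` is `C^r` near the constant path
`z`. -/
theorem eventually_contDiffAt_pathComp {E F : Type u} [NormedAddCommGroup E] [NormedSpace ℝ E]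
    [NormedAddCommGroup F] [NormedSpace ℝ F] [CompleteSpace F] {r : ℕ∞ω} (hr : r = ∞ ∨ r = ω)
    {h : E → F} {z : E} (hh : ∀ᶠ y in 𝓝 z, ContDiffAt ℝ r h y) :
    ∀ᶠ γ in 𝓝 (ContinuousMap.const K z), ContDiffAt ℝ r (pathComp h) γ := by
  rcases hr with rfl | rfl
  · obtain ⟨Ω, hΩ, ho, hz⟩ := eventually_nhds_iff.1 hh
    filter_upwards [(isOpen_setOf_forall_mem (K := K) ho).mem_nhds
      (show ContinuousMap.const K z ∈ _ from fun _ ↦ hz)] with γ hγ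
    refine contDiffAt_infty.2 fun n ↦ ContDiffOn.contDiffAt ?_
      ((isOpen_setOf_forall_mem (K := K) ho).mem_nhds hγ)
    exact contDiffOn_pathComp ho n fun y hy ↦
      ((hΩ y hy).of_le (mod_cast le_top)).contDiffWithinAt
  · have := analyticAt_pathComp_const (K := K) hh.self_of_nhds.analyticAt
    filter_upwards [this.eventually_analyticAt] with γ hγ using hγ.contDiffAt

end PathComp

/-! ### A `C^r` inverse function theorem on neighbourhoods -/

section LocalInverse

/-- Inverse function theorem: a map that is `C^r` on a neighbourhood of `a` with invertible
derivative at `a` has an inverse that is `C^r` on a neighbourhood of `f a`. For `r = ∞` this says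
more than `C^∞` at the point `f a`, which would allow neighbourhoods depending on the order of
differentiability. -/
theorem exists_openPartialHomeomorph_contDiffAt_symm {E F : Type*} [NormedAddCommGroup E]
    [NormedSpace ℝ E] [NormedAddCommGroup F] [NormedSpace ℝ F] [CompleteSpace E] {r : ℕ∞ω}
    (hr : r ≠ 0) {f : E → F} {a : E} (hf : ∀ᶠ z in 𝓝 a, ContDiffAt ℝ r f z) {f' : E ≃L[ℝ] F}
    (hf' : HasFDerivAt f (f' : E →L[ℝ] F) a) :
    ∃ e : OpenPartialHomeomorph E F, a ∈ e.source ∧ ⇑e = f ∧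
      ∀ᶠ y in 𝓝 (f a), ContDiffAt ℝ r e.symm y := by
  have ha := hf.self_of_nhds
  let e := ha.toOpenPartialHomeomorph f hf' hr
  have hae : a ∈ e.source := ha.mem_toOpenPartialHomeomorph_source hf' hr
  have hfe : f a ∈ e.target := e.map_source hae
  have hsymm : e.symm (f a) = a := e.left_inv hae
  refine ⟨e, hae, rfl, ?_⟩
  have hcont : ContinuousAt (fderiv ℝ f) a := (ha.fderiv_right (m := 0)
    (by simpa using ENat.one_le_iff_ne_zero_withTop.2 hr)).continuousAt
  have hinv : ∀ᶠ z in 𝓝 a, fderiv ℝ f z ∈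
      Set.range ((↑) : (E ≃L[ℝ] F) → E →L[ℝ] F) :=
    hcont (by rw [hf'.fderiv]; exact f'.nhds)
  have ht : Filter.Tendsto e.symm (𝓝 (f a)) (𝓝 a) := by
    have := (e.symm.continuousAt (x := f a) hfe).tendsto
    rwa [hsymm] at this
  filter_upwards [ht.eventually (hinv.and hf), e.open_target.mem_nhds hfe] with y hy hyt
  obtain ⟨⟨g, hg⟩, hy⟩ := hy
  refine e.contDiffAt_symm (f₀' := g) hyt ?_ hy
  rw [hg]
  exact (hy.differentiableAt hr).hasFDerivAt

end LocalInverse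

/-! ### Differential equations along rays -/

section Radial

/-- The segment from `(0, z)` to `(x, z)` lies in a given neighbourhood of `(0, z₀)` for `(x, z)`
near `(0, z₀)`. -/
theorem eventually_forall_segment {V Z : Type*} [NormedAddCommGroup V] [NormedSpace ℝ V]
    [NormedAddCommGroup Z] {z₀ : Z} {P : V × Z → Prop} (hP : ∀ᶠ w in 𝓝 ((0 : V), z₀), P w) :
    ∀ᶠ w in 𝓝 ((0 : V), z₀), ∀ t ∈ Set.Icc (0 : ℝ) 1, P (t • w.1, w.2) := by
  obtain ⟨δ, hδ, H⟩ := Metric.eventually_nhds_iff.1 hP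
  filter_upwards [Metric.ball_mem_nhds _ hδ] with w hw t ht
  rw [Metric.mem_ball, Prod.dist_eq, max_lt_iff] at hw
  refine H ?_
  rw [Prod.dist_eq, max_lt_iff]
  refine ⟨?_, hw.2⟩
  simp only [dist_zero_right] at hw ⊢
  rw [norm_smul, Real.norm_of_nonneg ht.1]
  exact (mul_le_of_le_one_left (norm_nonneg _) ht.2).trans_lt hw.1

variable {V Z : Type u} [NormedAddCommGroup V] [NormedSpace ℝ V]
  [NormedAddCommGroup Z] [NormedSpace ℝ Z]

local notation "𝕀" => Set.Icc (0 : ℝ) 1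

/-- Integration `γ ↦ (t ↦ ∫₀ᵗ γ)` of continuous paths on `[0, 1]`. -/
noncomputable def pathIntegral (Z : Type*) [NormedAddCommGroup Z] [NormedSpace ℝ Z] :
    C(𝕀, Z) →L[ℝ] C(𝕀, Z) :=
  LinearMap.mkContinuous
    { toFun := fun γ ↦ ⟨fun t ↦ ∫ s in (0 : ℝ)..t, γ (Set.projIcc 0 1 zero_le_one s),
        (intervalIntegral.continuous_primitive
          (fun a b ↦ Continuous.intervalIntegrable (by fun_prop) a b) 0).comp continuous_subtype_val⟩
      map_add' := fun γ η ↦ by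
        ext t
        exact intervalIntegral.integral_add (Continuous.intervalIntegrable (by fun_prop) _ _)
          (Continuous.intervalIntegrable (by fun_prop) _ _)
      map_smul' := fun c γ ↦ by
        ext t
        exact intervalIntegral.integral_smul _ _ } 1 fun γ ↦ by
    refine (ContinuousMap.norm_le _ (by positivity)).2 fun t ↦ ?_
    refine (intervalIntegral.norm_integral_le_of_norm_le_const
      fun s _ ↦ γ.norm_coe_le_norm _).trans ?_
    rw [sub_zero, abs_of_nonneg t.2.1, one_mul]
    exact mul_le_of_le_one_right (norm_nonneg _) t.2.2

theorem pathIntegral_apply (γ : C(𝕀, Z)) (t : 𝕀) :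
    pathIntegral Z γ t = ∫ s in (0 : ℝ)..t, γ (Set.projIcc 0 1 zero_le_one s) := rfl

/-- The path `t ↦ (t x, γ t)`, as a linear function of `(x, γ)`. -/
noncomputable def rayPath (V Z : Type*) [NormedAddCommGroup V] [NormedSpace ℝ V]
    [NormedAddCommGroup Z] [NormedSpace ℝ Z] : V × C(𝕀, Z) →L[ℝ] C(𝕀, V × Z) :=
  LinearMap.mkContinuous
    { toFun := fun a ↦ ⟨fun t ↦ ((t : ℝ) • a.1, a.2 t), by fun_prop⟩
      map_add' := fun a b ↦ by ext t <;> simp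
      map_smul' := fun c a ↦ by ext t <;> simp [smul_comm c] } 1 fun a ↦ by
    refine (ContinuousMap.norm_le _ (by positivity)).2 fun t ↦ ?_
    rw [one_mul]
    refine max_le_max ?_ (a.2.norm_coe_le_norm t)
    change ‖(t : ℝ) • a.1‖ ≤ _
    rw [norm_smul, Real.norm_of_nonneg t.2.1]
    exact mul_le_of_le_one_left (norm_nonneg _) t.2.2

@[simp]
theorem rayPath_apply (a : V × C(𝕀, Z)) (t : 𝕀) : rayPath V Z a t = ((t : ℝ) • a.1, a.2 t) := rfl

/-- Constant paths, as a linear function of the value. -/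
noncomputable def constPath (Z : Type*) [NormedAddCommGroup Z] [NormedSpace ℝ Z] :
    Z →L[ℝ] C(𝕀, Z) :=
  LinearMap.mkContinuous
    { toFun := fun z ↦ ContinuousMap.const _ z
      map_add' := fun a b ↦ rfl
      map_smul' := fun c a ↦ rfl } 1 fun a ↦ by
    refine (ContinuousMap.norm_le _ (by positivity)).2 fun t ↦ ?_
    rw [one_mul]; rfl

@[simp]
theorem constPath_apply (z : Z) (t : 𝕀) : constPath Z z t = z := rfl

/-- The right hand side `z + ∫₀ᵗ h(s x, γ s) x ds` of the integral equation satisfied by the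
solution `γ` of `γ' = h(t x, γ) x`, `γ(0) = z`. -/
noncomputable def radialPicard (h : V × Z → V →L[ℝ] Z) (a : (V × Z) × C(𝕀, Z)) : C(𝕀, Z) :=
  constPath Z a.1.2 + pathIntegral Z
    (pathApply V Z (pathComp h (rayPath V Z (a.1.1, a.2))) (constPath V a.1.1))

theorem eventually_contDiffAt_radialPicard {r : ℕ∞ω} (hr : r = ∞ ∨ r = ω) [CompleteSpace Z]
    {h : V × Z → V →L[ℝ] Z} {z₀ : Z} (hh : ∀ᶠ w in 𝓝 ((0 : V), z₀), ContDiffAt ℝ r h w) :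
    ∀ᶠ a in 𝓝 (((0 : V), z₀), constPath Z z₀), ContDiffAt ℝ r (radialPicard h) a := by
  have h₁ := eventually_contDiffAt_pathComp (K := 𝕀) hr hh
  let L : (V × Z) × C(𝕀, Z) →L[ℝ] C(𝕀, V × Z) := (rayPath V Z).comp
    (((ContinuousLinearMap.fst ℝ V Z).comp (ContinuousLinearMap.fst ℝ _ _)).prod
      (ContinuousLinearMap.snd ℝ _ _))
  have hL : L ((0, z₀), constPath Z z₀) = ContinuousMap.const 𝕀 ((0 : V), z₀) := by
    ext t <;> simp [L]
  have h₂ : Filter.Tendsto L (𝓝 ((0, z₀), constPath Z z₀))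
      (𝓝 (ContinuousMap.const 𝕀 ((0 : V), z₀))) := by
    rw [← hL]; exact L.continuous.continuousAt
  filter_upwards [h₂.eventually h₁] with a ha
  have h₃ : ContDiffAt ℝ r (fun a ↦ pathComp h (L a)) a := ha.comp a L.contDiff.contDiffAt
  unfold radialPicard
  refine ContDiffAt.add ((constPath Z).contDiff.contDiffAt.comp a (by fun_prop)) ?_
  refine (pathIntegral Z).contDiff.contDiffAt.comp a ?_
  have hP : ContDiff ℝ r fun η : C(𝕀, V →L[ℝ] Z) ↦ pathApply V Z η :=
    ContinuousLinearMap.contDiff _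
  exact ContDiffAt.clm_apply (hP.contDiffAt.comp a h₃)
    ((constPath V).contDiff.contDiffAt.comp a (by fun_prop))

/-- Equations `γ' = h(t x, γ) x` along the rays `t ↦ t x` can be solved on `[0, 1]` for `x` near
`0`, with solutions that depend on the direction `x` and on the initial value in a `C^r` way. The
implicit function theorem, applied in the space of continuous paths, gives the solution operator;
as rescaling the time and `x` turns solutions into solutions, the solution for `t x` at time `1`
is the solution for `x` at time `t`. -/
theorem exists_radial_solution {r : ℕ∞ω} (hr : r = ∞ ∨ r = ω) [CompleteSpace V] [CompleteSpace Z]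
    {h : V × Z → V →L[ℝ] Z} {z₀ : Z} (hh : ∀ᶠ w in 𝓝 ((0 : V), z₀), ContDiffAt ℝ r h w) :
    ∃ u : V × Z → Z, (∀ᶠ w in 𝓝 ((0 : V), z₀), ContDiffAt ℝ r u w) ∧
      u (0, z₀) = z₀ ∧ ∀ᶠ w in 𝓝 ((0 : V), z₀), u (0, w.2) = w.2 ∧
        ∀ t ∈ 𝕀, HasDerivWithinAt (fun s : ℝ ↦ u (s • w.1, w.2))
          (h (t • w.1, u (t • w.1, w.2)) w.1) 𝕀 t := by
  have hr0 : r ≠ 0 := by rcases hr with rfl | rfl <;> simp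
  set w₀ : V × Z := (0, z₀) with hw₀
  set γ₀ : C(𝕀, Z) := constPath Z z₀ with hγ₀
  let R : (V × Z) × C(𝕀, Z) → C(𝕀, Z) := radialPicard h
  have hR : ∀ᶠ a in 𝓝 (w₀, γ₀), ContDiffAt ℝ r R a := eventually_contDiffAt_radialPicard hr hh
  have hR0 (z : Z) (γ : C(𝕀, Z)) : R ((0, z), γ) = constPath Z z := by
    have : constPath V (0 : V) = 0 := map_zero _
    simp [R, radialPicard, this]
  let G : (V × Z) × C(𝕀, Z) → (V × Z) × C(𝕀, Z) := fun a ↦ (a.1, a.2 - R a)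
  have hG : ∀ᶠ a in 𝓝 (w₀, γ₀), ContDiffAt ℝ r G a := by
    filter_upwards [hR] with a ha
    exact contDiffAt_fst.prodMk (contDiffAt_snd.sub ha)
  have hRd : HasFDerivAt R (fderiv ℝ R (w₀, γ₀)) (w₀, γ₀) :=
    (hR.self_of_nhds.differentiableAt hr0).hasFDerivAt
  -- At `x = 0` the right hand side does not depend on `γ`, so its derivative is that in `(x, z)`.
  have hR' (w : V × Z) (γ : C(𝕀, Z)) :
      fderiv ℝ R (w₀, γ₀) (w, γ) = fderiv ℝ R (w₀, γ₀) (w, 0) := by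
    have h₁ : HasFDerivAt (fun γ : C(𝕀, Z) ↦ R (w₀, γ))
        ((fderiv ℝ R (w₀, γ₀)).comp (ContinuousLinearMap.inr ℝ (V × Z) C(𝕀, Z))) γ₀ :=
      hRd.comp γ₀ (hasFDerivAt_prodMk_right w₀ γ₀)
    have h₂ : HasFDerivAt (fun γ : C(𝕀, Z) ↦ R (w₀, γ)) (0 : C(𝕀, Z) →L[ℝ] C(𝕀, Z)) γ₀ := by
      simp only [hw₀, hR0]; exact hasFDerivAt_const _ _
    have h₃ := congrArg (fun A : C(𝕀, Z) →L[ℝ] C(𝕀, Z) ↦ A γ) (h₁.unique h₂)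
    simp only [ContinuousLinearMap.comp_apply, ContinuousLinearMap.inr_apply,
      zero_apply] at h₃
    have : ((w, γ) : (V × Z) × C(𝕀, Z)) = (w, 0) + (0, γ) := by simp
    rw [this, map_add, h₃, add_zero]
  let A : ((V × Z) × C(𝕀, Z)) ≃L[ℝ] (V × Z) × C(𝕀, Z) :=
    ContinuousLinearEquiv.skewProd (.refl ℝ _) (.refl ℝ _)
      (-(fderiv ℝ R (w₀, γ₀)).comp (ContinuousLinearMap.inl ℝ (V × Z) C(𝕀, Z)))
  have hGd : HasFDerivAt G (A : _ →L[ℝ] _) (w₀, γ₀) := by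
    refine (hasFDerivAt_fst.prodMk (hasFDerivAt_snd.sub hRd)).congr_fderiv ?_
    refine ContinuousLinearMap.ext fun ⟨w, γ⟩ ↦ ?_
    simp [A, hR' w γ, sub_eq_add_neg]
  obtain ⟨e, he, heG, hes⟩ := exists_openPartialHomeomorph_contDiffAt_symm hr0 hG hGd
  have hG0 : G (w₀, γ₀) = (w₀, 0) := by
    simp only [G, hw₀, hR0, hγ₀, sub_self]
  rw [hG0] at hes
  have he0 : ((w₀, 0) : (V × Z) × C(𝕀, Z)) ∈ e.target := by
    rw [← hG0, ← heG]; exact e.map_source he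
  have hsymm : e.symm (w₀, 0) = (w₀, γ₀) := by
    rw [← hG0, ← heG]; exact e.left_inv he
  let Γ : V × Z → C(𝕀, Z) := fun w ↦ (e.symm (w, 0)).2
  have hi : Filter.Tendsto (fun w : V × Z ↦ ((w, 0) : (V × Z) × C(𝕀, Z))) (𝓝 w₀)
      (𝓝 (w₀, 0)) := (by fun_prop : Continuous fun w : V × Z ↦ (w, (0 : C(𝕀, Z)))).continuousAt
  have hΓc : ∀ᶠ w in 𝓝 w₀, ContDiffAt ℝ r Γ w := by
    filter_upwards [hi.eventually hes] with w hw
    exact contDiffAt_snd.comp w (hw.comp w (contDiffAt_id.prodMk contDiffAt_const))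
  have hΓ0 : Γ w₀ = γ₀ := by simp only [Γ, hsymm]
  -- The solution operator: `Γ w` solves the integral equation and is its only solution near `γ₀`.
  have hsol : ∀ᶠ w in 𝓝 w₀, Γ w = R (w, Γ w) := by
    filter_upwards [hi.eventually (e.open_target.mem_nhds he0)] with w hw
    have h₁ : G (e.symm (w, 0)) = (w, 0) := by rw [← heG]; exact e.right_inv hw
    have h₂ : (e.symm (w, 0)).1 = w := congrArg Prod.fst h₁
    have h₃ : (e.symm (w, 0)).2 - R (e.symm (w, 0)) = 0 := congrArg Prod.snd h₁
    have h₄ : e.symm (w, 0) = (w, Γ w) := Prod.ext h₂ rfl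
    rw [h₄] at h₃
    exact sub_eq_zero.1 h₃
  obtain ⟨ε, hε, huniq⟩ : ∃ ε > 0, ∀ w γ, dist w w₀ < ε → dist γ γ₀ < ε → γ = R (w, γ) →
      Γ w = γ := by
    obtain ⟨ε, hε, H⟩ := Metric.mem_nhds_iff.1 (e.open_source.mem_nhds he)
    refine ⟨ε, hε, fun w γ hw hγ hs ↦ ?_⟩
    have h₁ : (w, γ) ∈ e.source := H (by rw [Metric.mem_ball, Prod.dist_eq]; exact max_lt hw hγ)
    have h₂ : e (w, γ) = (w, 0) := by
      rw [heG]; exact Prod.ext rfl (sub_eq_zero.2 hs)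
    have h₃ := e.left_inv h₁
    rw [h₂] at h₃
    exact congrArg Prod.snd h₃
  obtain ⟨δ, hδ, hcont⟩ := Metric.eventually_nhds_iff.1 hh
  have hclose : ∀ᶠ w in 𝓝 w₀, dist (Γ w) γ₀ < min ε δ := by
    have := hΓc.self_of_nhds.continuousAt.tendsto
    rw [hΓ0] at this
    exact this (Metric.ball_mem_nhds _ (lt_min hε hδ))
  refine ⟨fun w ↦ Γ w ⟨1, by simp⟩, ?_, by simp [hΓ0, hγ₀], ?_⟩
  · filter_upwards [hΓc] with w hw
    exact (ContinuousMap.evalCLM ℝ (⟨1, by simp⟩ : 𝕀)).contDiff.contDiffAt.comp w hw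
  have hnear : ∀ᶠ w in 𝓝 w₀, dist w w₀ < min ε δ := Metric.ball_mem_nhds _ (lt_min hε hδ)
  filter_upwards [hsol, hclose, eventually_forall_segment hnear] with ⟨x, z⟩ hw hc hs
  set γ : C(𝕀, Z) := Γ (x, z) with hγ
  -- the integrand is continuous
  have hk : Continuous (h ∘ rayPath V Z (x, γ)) := by
    refine continuous_iff_continuousAt.2 fun t ↦ ContinuousAt.comp ?_ (by fun_prop)
    refine (hcont ?_).continuousAt
    rw [Prod.dist_eq]
    refine max_lt ?_ ?_
    · have := hs t t.2
      rw [Prod.dist_eq] at this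
      exact ((le_max_left _ _).trans_lt this).trans_le (min_le_right _ _)
    · exact (ContinuousMap.dist_apply_le_dist t).trans_lt (hc.trans_le (min_le_right _ _))
  let k : ℝ → Z := fun s ↦ h (rayPath V Z (x, γ) (Set.projIcc 0 1 zero_le_one s)) x
  have hkc : Continuous k :=
    (hk.comp (continuous_projIcc (h := zero_le_one))).clm_apply continuous_const
  have hγt (t : 𝕀) : γ t = z + ∫ s in (0 : ℝ)..t, k s := by
    have h₁ : γ t = R ((x, z), γ) t := congrArg (fun η : C(𝕀, Z) ↦ η t) hw
    rw [h₁]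
    simp only [R, radialPicard, ContinuousMap.add_apply, constPath_apply, pathIntegral_apply,
      pathBilin_apply, pathComp_apply hk, k]
    rfl
  -- the solution for `t x` is the solution for `x` run with speed `t`
  have hscale (t : 𝕀) : Γ ((t : ℝ) • x, z) ⟨1, by simp⟩ = γ t := by
    let γt : C(𝕀, Z) := ⟨fun s ↦ γ ⟨t * s, unitInterval.mul_mem t.2 s.2⟩, by fun_prop⟩
    have h₁ : Γ ((t : ℝ) • x, z) = γt := by
      refine huniq _ _ ((hs t t.2).trans_le (min_le_left _ _)) ?_ ?_
      · refine lt_of_le_of_lt ((ContinuousMap.dist_le dist_nonneg).2 fun s ↦ ?_)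
          (hc.trans_le (min_le_left _ _))
        exact ContinuousMap.dist_apply_le_dist (f := γ) (g := γ₀) ⟨t * s, unitInterval.mul_mem t.2 s.2⟩
      · ext s
        have hk' : h ∘ rayPath V Z ((t : ℝ) • x, γt) = (h ∘ rayPath V Z (x, γ)) ∘
            fun s : 𝕀 ↦ (⟨t * s, unitInterval.mul_mem t.2 s.2⟩ : 𝕀) := by
          ext1 s
          simp [γt, smul_smul, mul_comm]
        have hkc' : Continuous (h ∘ rayPath V Z ((t : ℝ) • x, γt)) := by
          rw [hk']; exact hk.comp (by fun_prop)
        simp only [R, radialPicard, ContinuousMap.add_apply, constPath_apply, pathIntegral_apply,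
          pathBilin_apply, pathComp_apply hkc']
        have h₂ : γt s = z + ∫ σ in (0 : ℝ)..(t * s : ℝ), k σ := hγt _
        rw [h₂]
        congr 1
        have h₃ := intervalIntegral.smul_integral_comp_mul_left (a := 0) (b := (s : ℝ)) k (t : ℝ)
        rw [mul_zero] at h₃
        rw [← h₃, ← intervalIntegral.integral_smul]
        refine intervalIntegral.integral_congr fun σ hσ ↦ ?_
        rw [Set.uIcc_of_le s.2.1] at hσ
        have hσ' : σ ∈ 𝕀 := ⟨hσ.1, hσ.2.trans s.2.2⟩
        have h₄ := congrFun hk' ⟨σ, hσ'⟩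
        simp only [Function.comp_apply] at h₄
        simp only [k, Set.projIcc_of_mem zero_le_one hσ',
          Set.projIcc_of_mem zero_le_one (unitInterval.mul_mem t.2 hσ'), ContinuousLinearMap.id_apply, h₄,
          map_smul]
    rw [h₁]
    simp [γt]
  refine ⟨?_, fun t ht ↦ ?_⟩
  · have := hscale ⟨0, by simp⟩
    simp only [zero_smul] at this
    rw [this, hγt]
    simp
  · have h₁ : HasDerivWithinAt (fun s ↦ z + ∫ σ in (0 : ℝ)..s, k σ) (k t) 𝕀 t :=
      ((hkc.integral_hasStrictDerivAt 0 t).hasDerivAt.const_add z).hasDerivWithinAt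
    have h₂ : ∀ s ∈ 𝕀, Γ (s • x, z) ⟨1, by simp⟩ = z + ∫ σ in (0 : ℝ)..s, k σ :=
      fun s hs ↦ by rw [hscale ⟨s, hs⟩, hγt]
    have h₃ : k t = h (t • x, Γ (t • x, z) ⟨1, by simp⟩) x := by
      simp only [k, Set.projIcc_of_mem zero_le_one ht, rayPath_apply]
      rw [hscale ⟨t, ht⟩]
    simp only [← h₃]
    exact h₁.congr h₂ (h₂ t ht)

end Radial

/-! ### Derivatives on the unit interval -/

section UnitInterval

variable {F : Type*} [NormedAddCommGroup F] [NormedSpace ℝ F]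

theorem hasDerivWithinAt_Ici_of_Icc {f : ℝ → F} {f' : F} {t : ℝ} (ht : t ∈ Set.Ico (0 : ℝ) 1)
    (h : HasDerivWithinAt f f' (Set.Icc 0 1) t) : HasDerivWithinAt f f' (Set.Ici t) t :=
  h.mono_of_mem_nhdsWithin
    (Filter.mem_of_superset (Icc_mem_nhdsGE ht.2) (Set.Icc_subset_Icc_left ht.1))

theorem eq_of_hasDerivWithinAt_zero {f : ℝ → F}
    (h : ∀ t ∈ Set.Icc (0 : ℝ) 1, HasDerivWithinAt f 0 (Set.Icc 0 1) t) : f 1 = f 0 :=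
  constant_of_has_deriv_right_zero (fun t ht ↦ (h t ht).continuousWithinAt)
    (fun t ht ↦ hasDerivWithinAt_Ici_of_Icc ht (h t ⟨ht.1, ht.2.le⟩)) 1 (by simp)

end UnitInterval

/-! ### Frobenius' theorem for total differential equations -/

section Frobenius

variable {V W : Type u} [NormedAddCommGroup V] [NormedSpace ℝ V]
  [NormedAddCommGroup W] [NormedSpace ℝ W]

theorem hasDerivAt_segment {F : Type*} [NormedAddCommGroup F] [NormedSpace ℝ F] {g : V × W → F}
    {x : V} {y : W} {t : ℝ} (hg : DifferentiableAt ℝ g (t • x, y)) :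
    HasDerivAt (fun s : ℝ ↦ g (s • x, y)) (fderiv ℝ g (t • x, y) (x, 0)) t := by
  have h : HasDerivAt (fun s : ℝ ↦ (s • x, y)) (x, 0) t := by
    have := (hasDerivAt_id t).smul_const x
    rw [one_smul] at this
    exact this.prodMk (hasDerivAt_const t y)
  exact hg.hasFDerivAt.comp_hasDerivAt t h

/-- The radial derivative of the defect `c = ∂u/∂ξ - b(x, u) ξ` of a radial solution `u` of the
total differential equation `∂u/∂x = b(x, u)`, under the integrability condition on `b`. -/
theorem fderiv_defect_radial {b : V × W → V →L[ℝ] W} {u : V × W → W} {w : V × W}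
    (hu : ContDiffAt ℝ 2 u w) (hb : ContDiffAt ℝ 2 b (w.1, u w))
    (hint : ∀ v v', fderiv ℝ b (w.1, u w) (v, b (w.1, u w) v) v' =
      fderiv ℝ b (w.1, u w) (v', b (w.1, u w) v') v)
    (hrad : ∀ᶠ z in 𝓝 w, fderiv ℝ u z (z.1, 0) = b (z.1, u z) z.1) (ξ : V) :
    DifferentiableAt ℝ (fun z ↦ fderiv ℝ u z (ξ, 0) - b (z.1, u z) ξ) w ∧
    fderiv ℝ (fun z ↦ fderiv ℝ u z (ξ, 0) - b (z.1, u z) ξ) w (w.1, 0) =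
      fderiv ℝ b (w.1, u w) (0, fderiv ℝ u w (ξ, 0) - b (w.1, u w) ξ) w.1 -
        (fderiv ℝ u w (ξ, 0) - b (w.1, u w) ξ) := by
  have h₁ : HasFDerivAt u (fderiv ℝ u w) w := (hu.differentiableAt two_ne_zero).hasFDerivAt
  have h₂ : HasFDerivAt (fderiv ℝ u) (fderiv ℝ (fderiv ℝ u) w) w :=
    ((hu.fderiv_right (m := 1) (by norm_num)).differentiableAt one_ne_zero).hasFDerivAt
  have h₃ : HasFDerivAt (fun z : V × W ↦ (z.1, u z))
      ((ContinuousLinearMap.fst ℝ V W).prod (fderiv ℝ u w)) w := hasFDerivAt_fst.prodMk h₁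
  have h₄ : HasFDerivAt (fun z : V × W ↦ b (z.1, u z))
      ((fderiv ℝ b (w.1, u w)).comp ((ContinuousLinearMap.fst ℝ V W).prod (fderiv ℝ u w))) w :=
    HasFDerivAt.comp (f := fun z : V × W ↦ (z.1, u z)) w
      (hb.differentiableAt two_ne_zero).hasFDerivAt h₃
  have h₅ : HasFDerivAt (fun z ↦ fderiv ℝ u z (ξ, 0) - b (z.1, u z) ξ) _ w :=
    (h₂.clm_apply (hasFDerivAt_const ((ξ, 0) : V × W) w)).sub
    (h₄.clm_apply (hasFDerivAt_const ξ w))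
  refine ⟨h₅.differentiableAt, ?_⟩
  rw [h₅.fderiv]
  have hsymm : fderiv ℝ (fderiv ℝ u) w (w.1, 0) (ξ, 0) = fderiv ℝ (fderiv ℝ u) w (ξ, 0) (w.1, 0) :=
    hu.isSymmSndFDerivAt (by simp) _ _
  -- the derivative of the radial equation in the direction `ξ`
  have h₆ : HasFDerivAt (fun z : V × W ↦ ((z.1, 0) : V × W))
      ((ContinuousLinearMap.inl ℝ V W).comp (ContinuousLinearMap.fst ℝ V W)) w :=
    ((ContinuousLinearMap.inl ℝ V W).comp (ContinuousLinearMap.fst ℝ V W)).hasFDerivAt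
  have h₇ := ((h₂.clm_apply h₆).congr_of_eventuallyEq
    (f₁ := fun z ↦ b (z.1, u z) z.1) (hrad.mono fun z hz ↦ hz.symm)).unique
    (h₄.clm_apply hasFDerivAt_fst)
  have h₈ := congrArg (fun A : V × W →L[ℝ] W ↦ A (ξ, 0)) h₇
  have hrad' := hrad.self_of_nhds
  have hi := hint ξ w.1
  have hsplit : ∀ η : W, fderiv ℝ b (w.1, u w) (ξ, η) w.1 =
      fderiv ℝ b (w.1, u w) (ξ, b (w.1, u w) ξ) w.1 +
        fderiv ℝ b (w.1, u w) (0, η - b (w.1, u w) ξ) w.1 := fun η ↦ by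
    rw [← add_apply, ← map_add]
    simp
  simp only [add_apply, sub_apply, ContinuousLinearMap.comp_apply, ContinuousLinearMap.flip_apply,
    ContinuousLinearMap.prod_apply, ContinuousLinearMap.coe_fst', ContinuousLinearMap.inl_apply,
    zero_apply, map_zero, zero_add] at h₈ ⊢
  rw [hrad', hsymm, ← hi]
  rw [hsplit] at h₈
  rw [← eq_sub_iff_add_eq'] at h₈
  rw [h₈]
  abel

/-- Frobenius' theorem for the total differential equation `∂u/∂x = b(x, u)`, `u(0, y) = y`: under
the integrability condition on `b`, the solutions along rays solve the whole equation. -/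
theorem exists_total_solution [CompleteSpace V] [CompleteSpace W] {r : ℕ∞ω} (hr : r = ∞ ∨ r = ω)
    {b : V × W → V →L[ℝ] W} (hb : ∀ᶠ z in 𝓝 (0 : V × W), ContDiffAt ℝ r b z)
    (hint : ∀ᶠ z in 𝓝 (0 : V × W), ∀ v v',
      fderiv ℝ b z (v, b z v) v' = fderiv ℝ b z (v', b z v') v) :
    ∃ u : V × W → W, (∀ᶠ z in 𝓝 0, ContDiffAt ℝ r u z) ∧ u 0 = 0 ∧
      (∀ᶠ z in 𝓝 (0 : V × W), u (0, z.2) = z.2) ∧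
      ∀ᶠ z in 𝓝 (0 : V × W), ∀ ξ, fderiv ℝ u z (ξ, 0) = b (z.1, u z) ξ := by
  have hr0 : r ≠ 0 := by rcases hr with rfl | rfl <;> simp
  have hr2 : 2 ≤ r := by
    rcases hr with rfl | rfl
    exacts [WithTop.coe_le_coe.2 (le_top : (2 : ℕ∞) ≤ ⊤), le_top]
  obtain ⟨u, huc, hu0, hu⟩ := exists_radial_solution hr (h := b) (z₀ := (0 : W)) hb
  change ∀ᶠ w in 𝓝 (0 : V × W), _ at huc
  change u 0 = 0 at hu0
  change ∀ᶠ w in 𝓝 (0 : V × W), _ at hu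
  let Ψ : V × W → V × W := fun z ↦ (z.1, u z)
  have hΨ0 : Ψ 0 = 0 := Prod.ext rfl hu0
  have hΨc : ∀ᶠ z in 𝓝 0, ContDiffAt ℝ r Ψ z := huc.mono fun z hz ↦ contDiffAt_fst.prodMk hz
  have hΨt : Filter.Tendsto Ψ (𝓝 0) (𝓝 0) := by
    have := hΨc.self_of_nhds.continuousAt.tendsto
    rwa [hΨ0] at this
  have hrad : ∀ᶠ z in 𝓝 (0 : V × W), fderiv ℝ u z (z.1, 0) = b (z.1, u z) z.1 := by
    filter_upwards [hu, huc] with z hz hc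
    have h₁ := hz.2 1 (by simp)
    have h₂ := (hasDerivAt_segment (g := u) (x := z.1) (y := z.2) (t := 1)
      (by simpa using hc.differentiableAt hr0)).hasDerivWithinAt (s := Set.Icc 0 1)
    have h₃ := UniqueDiffWithinAt.eq_deriv _ (uniqueDiffOn_Icc zero_lt_one 1 (by simp)) h₂ h₁
    simpa using h₃
  have hbound : ∃ κ, ∀ᶠ z in 𝓝 (0 : V × W), ‖fderiv ℝ b (Ψ z)‖ ≤ κ := by
    have h₁ : ContinuousAt (fderiv ℝ b) 0 := ((hb.self_of_nhds.of_le hr2).fderiv_right (m := 1)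
      (by norm_num)).continuousAt
    have h₂ : Filter.Tendsto (fun z ↦ ‖fderiv ℝ b (Ψ z)‖) (𝓝 0) (𝓝 ‖fderiv ℝ b 0‖) :=
      Filter.Tendsto.norm (E := V × W →L[ℝ] V →L[ℝ] W) (h₁.tendsto.comp hΨt)
    exact ⟨‖fderiv ℝ b 0‖ + 1, h₂.eventually (eventually_le_nhds (lt_add_one _))⟩
  obtain ⟨κ, hκ⟩ := hbound
  -- the defect vanishes, so `u` solves the total differential equation
  refine ⟨u, huc, hu0, hu.mono fun z hz ↦ hz.1, ?_⟩
  have hseg := eventually_forall_segment (V := V) (z₀ := (0 : W))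
    (huc.and ((hΨt.eventually hb).and ((hΨt.eventually hint).and
      (hrad.eventually_nhds.and hκ))))
  change ∀ᶠ w in 𝓝 (0 : V × W), _ at hseg
  filter_upwards [hseg] with ⟨x, y⟩ hz ξ
  let c : V × W → W := fun z ↦ fderiv ℝ u z (ξ, 0) - b (z.1, u z) ξ
  let f : ℝ → W := fun t ↦ t • c (t • x, y)
  have hf : ∀ t ∈ Set.Icc (0 : ℝ) 1,
      HasDerivAt f (fderiv ℝ b (Ψ (t • x, y)) (0, f t) x) t := fun t ht ↦ by
    obtain ⟨h₁, h₂, h₃, h₄, -⟩ := hz t ht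
    obtain ⟨hd, hc⟩ := fderiv_defect_radial (h₁.of_le hr2) (h₂.of_le hr2) h₃ h₄ ξ
    have h₅ := (hasDerivAt_id t).smul (hasDerivAt_segment hd)
    refine h₅.congr_deriv ?_
    have h₆ : fderiv ℝ c (t • x, y) (t • x, 0) = t • fderiv ℝ c (t • x, y) (x, 0) := by
      rw [← map_smul]; simp
    have h₇ : fderiv ℝ b (Ψ (t • x, y)) (0, f t) x =
        fderiv ℝ b (Ψ (t • x, y)) (0, c (t • x, y)) (t • x) := by
      have : ((0, f t) : V × W) = t • ((0, c (t • x, y)) : V × W) := by simp [f]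
      rw [this, map_smul, map_smul, smul_apply]
    rw [h₇]
    change t • fderiv ℝ c (t • x, y) (x, 0) + (1 : ℝ) • c (t • x, y) = _
    rw [← h₆, one_smul]
    change fderiv ℝ c (t • x, y) (t • x, 0) = fderiv ℝ b (Ψ (t • x, y)) (0, c (t • x, y)) (t • x) -
      c (t • x, y) at hc
    rw [hc]
    abel
  have h₁ := norm_le_gronwallBound_of_norm_deriv_right_le (f := f) (δ := 0) (K := κ * ‖x‖) (ε := 0)
    (a := 0) (b := 1) (fun t ht ↦ (hf t ht).continuousAt.continuousWithinAt)
    (fun t ht ↦ (hf t ⟨ht.1, ht.2.le⟩).hasDerivWithinAt) (by simp [f])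
    (fun t ht ↦ ?_) 1 (by simp)
  · rw [gronwallBound_ε0_δ0] at h₁
    have h₂ : c (x, y) = 0 := by simpa [f] using h₁
    exact sub_eq_zero.1 h₂
  · rw [add_zero]
    refine (ContinuousLinearMap.le_opNorm _ _).trans ?_
    have h₂ := (hz t ⟨ht.1, ht.2.le⟩).2.2.2.2
    calc ‖fderiv ℝ b (Ψ (t • x, y)) (0, f t)‖ * ‖x‖
        ≤ (‖fderiv ℝ b (Ψ (t • x, y))‖ * ‖((0, f t) : V × W)‖) * ‖x‖ := by
          gcongr; exact ContinuousLinearMap.le_opNorm _ _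
      _ ≤ (κ * ‖f t‖) * ‖x‖ := by
          refine mul_le_mul_of_nonneg_right (mul_le_mul h₂ ?_ (norm_nonneg _)
            ((norm_nonneg (fderiv ℝ b (Ψ (t • x, y)))).trans h₂)) (norm_nonneg _)
          simp [Prod.norm_def]
      _ = κ * ‖x‖ * ‖f t‖ := by ring

/-- Frobenius' theorem for total differential equations: if `b` satisfies the integrability
condition, the graphs of the maps `b z` are straightened by a local diffeomorphism. -/
theorem exists_straightening [CompleteSpace V] [CompleteSpace W] {r : ℕ∞ω} (hr : r = ∞ ∨ r = ω)
    {b : V × W → V →L[ℝ] W} (hb : ∀ᶠ z in 𝓝 (0 : V × W), ContDiffAt ℝ r b z)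
    (hint : ∀ᶠ z in 𝓝 (0 : V × W), ∀ v v',
      fderiv ℝ b z (v, b z v) v' = fderiv ℝ b z (v', b z v') v) :
    ∃ Θ : OpenPartialHomeomorph (V × W) (V × W), 0 ∈ Θ.source ∧ Θ 0 = 0 ∧
      (∀ᶠ z in 𝓝 0, ContDiffAt ℝ r Θ z) ∧ (∀ᶠ z in 𝓝 0, ContDiffAt ℝ r Θ.symm z) ∧
      ∀ᶠ z in 𝓝 0, ∀ v, fderiv ℝ Θ z (v, b z v) = (v, 0) := by
  have hr0 : r ≠ 0 := by rcases hr with rfl | rfl <;> simp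
  obtain ⟨u, huc, hu0, hu, hdef⟩ := exists_total_solution hr hb hint
  let Ψ : V × W → V × W := fun z ↦ (z.1, u z)
  have hΨ0 : Ψ 0 = 0 := Prod.ext rfl hu0
  have hΨc : ∀ᶠ z in 𝓝 0, ContDiffAt ℝ r Ψ z := huc.mono fun z hz ↦ contDiffAt_fst.prodMk hz
  have hud : HasFDerivAt u (fderiv ℝ u 0) 0 :=
    (huc.self_of_nhds.differentiableAt hr0).hasFDerivAt
  have hu' (η : W) : fderiv ℝ u 0 (0, η) = η := by
    have h₁ : HasFDerivAt (fun y : W ↦ u (0, y))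
        ((fderiv ℝ u 0).comp (ContinuousLinearMap.inr ℝ V W)) 0 :=
      HasFDerivAt.comp (f := fun y : W ↦ ((0, y) : V × W)) 0 hud (hasFDerivAt_prodMk_right 0 0)
    have hi : Filter.Tendsto (fun y : W ↦ ((0, y) : V × W)) (𝓝 0) (𝓝 0) :=
      (by fun_prop : Continuous fun y : W ↦ ((0 : V), y)).continuousAt
    have h₂ := h₁.unique ((hasFDerivAt_id (0 : W)).congr_of_eventuallyEq
      (hi.eventually hu))
    exact congrArg (fun A : W →L[ℝ] W ↦ A η) h₂
  let A : (V × W) ≃L[ℝ] V × W := ContinuousLinearEquiv.skewProd (.refl ℝ V) (.refl ℝ W)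
    ((fderiv ℝ u 0).comp (ContinuousLinearMap.inl ℝ V W))
  have hΨd : HasFDerivAt Ψ (A : V × W →L[ℝ] V × W) 0 := by
    refine (hasFDerivAt_fst.prodMk hud).congr_fderiv (ContinuousLinearMap.ext fun ⟨v, η⟩ ↦ ?_)
    have : ((v, η) : V × W) = (v, 0) + (0, η) := by simp
    change (v, fderiv ℝ u 0 (v, η)) = (v, η + fderiv ℝ u 0 (v, 0))
    rw [this, map_add, hu', add_comm]
  obtain ⟨e, he, heΨ, hes⟩ := exists_openPartialHomeomorph_contDiffAt_symm hr0 hΨc hΨd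
  rw [hΨ0] at hes
  have he0 : e 0 = 0 := by rw [heΨ, hΨ0]
  have het : (0 : V × W) ∈ e.target := by have := e.map_source he; rwa [he0] at this
  have hsymm0 : e.symm 0 = 0 := by have := e.left_inv he; rwa [he0] at this
  refine ⟨e.symm, by simpa using het, hsymm0, hes, by simpa [heΨ] using hΨc, ?_⟩
  have hst : Filter.Tendsto e.symm (𝓝 0) (𝓝 0) := by
    have := (e.symm.continuousAt (x := 0) (by simpa using het)).tendsto
    rwa [hsymm0] at this
  filter_upwards [hst.eventually (hdef.and (huc.and (e.open_source.mem_nhds he))), hes,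
    e.open_target.mem_nhds het] with z hz hc hzt v
  obtain ⟨hd, huc, hzs⟩ := hz
  have hz : Ψ (e.symm z) = z := by rw [← heΨ]; exact e.right_inv hzt
  have h₁ : HasFDerivAt Ψ ((ContinuousLinearMap.fst ℝ V W).prod (fderiv ℝ u (e.symm z)))
      (e.symm z) := hasFDerivAt_fst.prodMk (huc.differentiableAt hr0).hasFDerivAt
  have h₂ : HasFDerivAt e.symm (fderiv ℝ e.symm z) (Ψ (e.symm z)) := by
    rw [hz]; exact (hc.differentiableAt hr0).hasFDerivAt
  have h₃ := (h₂.comp _ h₁).unique ((hasFDerivAt_id (e.symm z)).congr_of_eventuallyEq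
    (Filter.Eventually.mono (e.open_source.mem_nhds hzs) fun w hw ↦ by
      have := e.left_inv hw
      rwa [heΨ] at this))
  have h₄ := congrArg (fun A : V × W →L[ℝ] V × W ↦ A (v, 0)) h₃
  change fderiv ℝ e.symm z (v, fderiv ℝ u (e.symm z) (v, 0)) = (v, 0) at h₄
  rw [hd] at h₄
  change fderiv ℝ e.symm z (v, b (Ψ (e.symm z)) v) = (v, 0) at h₄
  rwa [hz] at h₄

end Frobenius

/-! ### The radial gauge -/

section Transport

variable {V W P : Type u} [NormedAddCommGroup V] [NormedSpace ℝ V]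
  [NormedAddCommGroup W] [NormedSpace ℝ W] [NormedAddCommGroup P] [NormedSpace ℝ P]

/-- Radial gauge: given linear maps `C z v` depending on `z` in a `C^r` way and linearly on `v`,
there are linear maps `B z`, invertible near `0`, such that `B n` is constant in the first
variable for every solution `n` of the linear equation `∂n/∂v = -C v n`. The equation need not
have any solutions but zero: no curvature condition is imposed on `C`, because `B` solves the
equation dual to it along the rays through `x = 0` only. -/
theorem exists_radial_gauge [CompleteSpace V] [CompleteSpace W] [CompleteSpace P] {r : ℕ∞ω}
    (hr : r = ∞ ∨ r = ω) {C : V × W → V →L[ℝ] P →L[ℝ] P}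
    (hC : ∀ᶠ z in 𝓝 (0 : V × W), ContDiffAt ℝ r C z) :
    ∃ B : V × W → P →L[ℝ] P, (∀ᶠ z in 𝓝 0, ContDiffAt ℝ r B z) ∧
      B 0 = ContinuousLinearMap.id ℝ P ∧
      (∀ a, (∀ᶠ z in 𝓝 0, ∀ v, C z v a = 0) → ∀ᶠ z in 𝓝 0, B z a = a) ∧
      ∀ n : V × W → P, (∀ᶠ z in 𝓝 0, DifferentiableAt ℝ n z) →
        (∀ᶠ z in 𝓝 0, ∀ v, fderiv ℝ n z (v, 0) = -C z v (n z)) →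
        ∀ᶠ z in 𝓝 0, ∀ v, fderiv ℝ (fun z ↦ B z (n z)) z (v, 0) = 0 := by
  let one : P →L[ℝ] P := ContinuousLinearMap.id ℝ P
  let h : V × (W × (P →L[ℝ] P)) → V →L[ℝ] (W × (P →L[ℝ] P)) := fun a ↦
    (ContinuousLinearMap.inr ℝ W (P →L[ℝ] P)).comp
      ((ContinuousLinearMap.compL ℝ P P P a.2.2).comp (C (a.1, a.2.1)))
  have hh : ∀ᶠ a in 𝓝 ((0 : V), ((0 : W), one)), ContDiffAt ℝ r h a := by
    have ht : Filter.Tendsto (fun a : V × (W × (P →L[ℝ] P)) ↦ (a.1, a.2.1))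
        (𝓝 (0, (0, one))) (𝓝 0) :=
      (by fun_prop : Continuous fun a : V × (W × (P →L[ℝ] P)) ↦ (a.1, a.2.1)).continuousAt
    filter_upwards [ht.eventually hC] with a ha
    have h₁ : ContDiffAt ℝ r (fun a : V × (W × (P →L[ℝ] P)) ↦ C (a.1, a.2.1)) a :=
      ContDiffAt.comp (f := fun a : V × (W × (P →L[ℝ] P)) ↦ (a.1, a.2.1)) a ha (by fun_prop)
    have h₂ : ContDiffAt ℝ r (fun a : V × (W × (P →L[ℝ] P)) ↦
        ContinuousLinearMap.compL ℝ P P P a.2.2) a :=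
      (ContinuousLinearMap.compL ℝ P P P).contDiff.contDiffAt.comp a (by fun_prop)
    exact contDiffAt_const.clm_comp (h₂.clm_comp h₁)
  obtain ⟨u, huc, hu0, hu⟩ := exists_radial_solution hr hh
  have hj : Filter.Tendsto (fun z : V × W ↦ ((z.1, (z.2, one)) : V × (W × (P →L[ℝ] P)))) (𝓝 0)
      (𝓝 (0, (0, one))) :=
    (by fun_prop : Continuous fun z : V × W ↦ (z.1, (z.2, one))).continuousAt
  let B : V × W → P →L[ℝ] P := fun z ↦ (u (z.1, (z.2, one))).2
  -- along rays, `B` solves `B' = B C`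
  have hB : ∀ᶠ z in 𝓝 (0 : V × W), B (0, z.2) = one ∧ ∀ t ∈ Set.Icc (0 : ℝ) 1,
      HasDerivWithinAt (fun s : ℝ ↦ B (s • z.1, z.2))
        ((B (t • z.1, z.2)).comp (C (t • z.1, z.2) z.1)) (Set.Icc 0 1) t := by
    have hseg := eventually_forall_segment (V := V) (z₀ := (0 : W)) (hj.eventually hu)
    change ∀ᶠ w in 𝓝 (0 : V × W), _ at hseg
    filter_upwards [hj.eventually hu, hseg] with ⟨x, y⟩ hz hzs
    have h₁ (t : ℝ) (ht : t ∈ Set.Icc (0 : ℝ) 1) : (u (t • x, (y, one))).1 = y := by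
      have h₂ := hzs t ht
      have h₃ : (fun s : ℝ ↦ (u (s • (t • x), (y, one))).1) 1 =
          (fun s : ℝ ↦ (u (s • (t • x), (y, one))).1) 0 :=
        eq_of_hasDerivWithinAt_zero fun s hs ↦
          (hasFDerivAt_fst.comp_hasDerivWithinAt s (h₂.2 s hs)).congr_deriv (by simp [h])
      have h₄ := h₂.1
      simp only [one_smul, zero_smul] at h₃ h₄
      rw [h₃, h₄]
    refine ⟨by simp only [B]; rw [hz.1], fun t ht ↦ ?_⟩
    refine (hasFDerivAt_snd.comp_hasDerivWithinAt t (hz.2 t ht)).congr_deriv ?_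
    simp [h, B, h₁ t ht]
  have hBc : ∀ᶠ z in 𝓝 0, ContDiffAt ℝ r B z := by
    filter_upwards [hj.eventually huc] with z hz
    exact contDiffAt_snd.comp z
      (ContDiffAt.comp (f := fun z : V × W ↦ (z.1, (z.2, one))) z hz (by fun_prop))
  refine ⟨B, hBc, congrArg Prod.snd hu0, fun a ha ↦ ?_, fun n hn hd ↦ ?_⟩
  · have hseg := eventually_forall_segment (V := V) (z₀ := (0 : W)) ha
    change ∀ᶠ w in 𝓝 (0 : V × W), _ at hseg
    filter_upwards [hB, hseg] with ⟨x, y⟩ hz hs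
    have h₁ : (fun s : ℝ ↦ B (s • x, y) a) 1 = (fun s : ℝ ↦ B (s • x, y) a) 0 :=
      eq_of_hasDerivWithinAt_zero fun s hs' ↦
        ((hz.2 s hs').clm_apply (hasDerivWithinAt_const s _ a)).congr_deriv (by simp [hs s hs'])
    simp only [one_smul, zero_smul] at h₁ hz
    rw [h₁, hz.1]
    rfl
  · have hseg := eventually_forall_segment (V := V) (z₀ := (0 : W)) (hn.and hd)
    change ∀ᶠ w in 𝓝 (0 : V × W), _ at hseg
    have hconst : ∀ᶠ z in 𝓝 (0 : V × W), B z (n z) = n (0, z.2) := by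
      filter_upwards [hB, hseg] with ⟨x, y⟩ hz hs
      have h₁ : (fun s : ℝ ↦ B (s • x, y) (n (s • x, y))) 1 =
          (fun s : ℝ ↦ B (s • x, y) (n (s • x, y))) 0 :=
        eq_of_hasDerivWithinAt_zero fun s hs' ↦
          ((hz.2 s hs').clm_apply
            (hasDerivAt_segment (hs s hs').1).hasDerivWithinAt).congr_deriv
              (by simp [(hs s hs').2])
      simp only [one_smul, zero_smul] at h₁ hz
      rw [h₁, hz.1]
      rfl
    have ht : Filter.Tendsto (fun z : V × W ↦ ((0 : V), z.2)) (𝓝 0) (𝓝 0) :=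
      (by fun_prop : Continuous fun z : V × W ↦ ((0 : V), z.2)).continuousAt
    filter_upwards [hconst.eventually_nhds, ht.eventually hn] with z hz hnz v
    have h₁ : HasFDerivAt (fun z : V × W ↦ ((0 : V), z.2))
        ((ContinuousLinearMap.inr ℝ V W).comp (ContinuousLinearMap.snd ℝ V W)) z :=
      ((ContinuousLinearMap.inr ℝ V W).comp (ContinuousLinearMap.snd ℝ V W)).hasFDerivAt
    have h₂ := HasFDerivAt.comp (f := fun z : V × W ↦ ((0 : V), z.2)) z hnz.hasFDerivAt h₁
    rw [(h₂.congr_of_eventuallyEq hz).fderiv]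
    exact map_zero (fderiv ℝ n (0, z.2))

end Transport

/-! ### Derivatives along vector fields and the Lie bracket -/

section DirectionalDerivative

variable {E : Type*} [NormedAddCommGroup E] [NormedSpace ℝ E]
  {M : Type*} [TopologicalSpace M] [ChartedSpace E M]
  {F : Type*} [NormedAddCommGroup F] [NormedSpace ℝ F]
  {G : Type*} [NormedAddCommGroup G] [NormedSpace ℝ G]

/-- The derivative of a vector-valued function `φ` on `M` along the vector field `X`. -/
noncomputable def dirDeriv (X : VField E M) (φ : M → F) (q : M) : F :=
  mvfderiv 𝓘(ℝ, E) φ q (X q)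

theorem dirDeriv_congr {X : VField E M} {φ ψ : M → F} {q : M} (h : φ =ᶠ[𝓝 q] ψ) :
    dirDeriv X φ q = dirDeriv X ψ q := by
  have : mfderiv 𝓘(ℝ, E) 𝓘(ℝ, F) φ q = mfderiv 𝓘(ℝ, E) 𝓘(ℝ, F) ψ q := h.mfderiv_eq
  change (mfderiv 𝓘(ℝ, E) 𝓘(ℝ, F) φ q : E →L[ℝ] F) (X q) =
    (mfderiv 𝓘(ℝ, E) 𝓘(ℝ, F) ψ q : E →L[ℝ] F) (X q)
  exact congrArg (fun A : E →L[ℝ] F ↦ A (X q)) this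

theorem dirDeriv_of_eventually_eq_const {X : VField E M} {φ : M → F} {q : M} {c : F}
    (h : ∀ᶠ q' in 𝓝 q, φ q' = c) : dirDeriv X φ q = 0 := by
  rw [dirDeriv_congr (ψ := fun _ ↦ c) h, dirDeriv, mvfderiv_const]
  rfl

theorem dirDeriv_comp {X : VField E M} {φ : M → F} {g : F → G} {q : M}
    (hg : DifferentiableAt ℝ g (φ q)) (hφ : MDifferentiableAt 𝓘(ℝ, E) 𝓘(ℝ, F) φ q) :
    dirDeriv X (fun q' ↦ g (φ q')) q = fderiv ℝ g (φ q) (dirDeriv X φ q) := by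
  have h := mfderiv_comp_apply q hg.mdifferentiableAt hφ (X q)
  rw [mfderiv_eq_fderiv] at h
  exact h

variable [IsManifold 𝓘(ℝ, E) ∞ M]

theorem contMDiffVectorBundle_tangent {r : ℕ∞ω} (hr : r = ∞ ∨ r = ω) [IsManifold 𝓘(ℝ, E) r M] :
    ContMDiffVectorBundle r E (TangentSpace 𝓘(ℝ, E) : M → Type _) 𝓘(ℝ, E) := by
  rcases hr with rfl | rfl <;> infer_instance

/-- The vector field `X` is of class `C^r` at the point `q`. -/
abbrev IsCrAt (r : ℕ∞ω) (X : VField E M) (q : M) : Prop :=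
  ContMDiffAt 𝓘(ℝ, E) (𝓘(ℝ, E)).tangent r
    (fun x ↦ (⟨x, X x⟩ : TangentBundle 𝓘(ℝ, E) M)) q

theorem contMDiffAt_dirDeriv {r : ℕ∞ω} (hr : r = ∞ ∨ r = ω) [IsManifold 𝓘(ℝ, E) r M]
    {X : VField E M} {φ : M → F} {q : M} (hX : IsCrAt r X q)
    (hφ : ContMDiffAt 𝓘(ℝ, E) 𝓘(ℝ, F) r φ q) :
    ContMDiffAt 𝓘(ℝ, E) 𝓘(ℝ, F) r (dirDeriv X φ) q := by
  have hr1 : r + 1 ≤ r := by rcases hr with rfl | rfl <;> simp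
  have h₁ := ContMDiffAt.mfderiv_const hφ hr1
  have := contMDiffVectorBundle_tangent (M := M) (E := E) hr
  have h₂ := ContMDiffAt.clm_apply_of_inCoordinates (b₁ := id) (b₂ := φ)
    (ϕ := fun q ↦ mfderiv 𝓘(ℝ, E) 𝓘(ℝ, F) φ q) h₁ hX hφ
  exact (contMDiff_snd_tangentBundle_modelSpace F 𝓘(ℝ, F)).contMDiffAt.comp q h₂

/-- The Lie bracket acts on functions as the commutator of the derivatives along the two fields. -/
theorem dirDeriv_mlieBracket {r : ℕ∞ω} (hr : r = ∞ ∨ r = ω) [IsManifold 𝓘(ℝ, E) r M]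
    [CompleteSpace E]
    {X Y : VField E M} {φ : M → F} {q : M} (hX : IsCrAt r X q) (hY : IsCrAt r Y q)
    (hφ : ∀ᶠ q' in 𝓝 q, ContMDiffAt 𝓘(ℝ, E) 𝓘(ℝ, F) r φ q') :
    dirDeriv (VectorField.mlieBracket 𝓘(ℝ, E) X Y) φ q =
      dirDeriv X (dirDeriv Y φ) q - dirDeriv Y (dirDeriv X φ) q := by
  have hr0 : r ≠ 0 := by rcases hr with rfl | rfl <;> simp
  have hr2 : 2 ≤ r := by
    rcases hr with rfl | rfl
    exacts [WithTop.coe_le_coe.2 (le_top : (2 : ℕ∞) ≤ ⊤), le_top]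
  set χ := extChartAt 𝓘(ℝ, E) q with hχ
  set z₀ := χ q with hz₀
  have hz : χ.symm z₀ = q := extChartAt_to_inv q
  -- the local representatives of `X` and `Y`
  let rep : VField E M → E → E := fun Z ↦
    VectorField.mpullbackWithin 𝓘(ℝ, E) 𝓘(ℝ, E) χ.symm Z (Set.range 𝓘(ℝ, E))
  have hrange : Set.range 𝓘(ℝ, E) = Set.univ := by simp
  have htarget : χ.target ∈ 𝓝 z₀ := extChartAt_target_mem_nhds q
  have hsymm : Filter.Tendsto χ.symm (𝓝 z₀) (𝓝 q) := by
    have := (continuousAt_extChartAt_symm (I := 𝓘(ℝ, E)) q).tendsto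
    rwa [extChartAt_to_inv] at this
  have hrep {g : M → F} {z : E}
      (hz : z ∈ χ.target) (hg : MDifferentiableAt 𝓘(ℝ, E) 𝓘(ℝ, F) g (χ.symm z)) (Z : VField E M) :
      fderiv ℝ (fun z ↦ g (χ.symm z)) z (rep Z z) = dirDeriv Z g (χ.symm z) := by
    have hs : MDifferentiableAt 𝓘(ℝ, E) 𝓘(ℝ, E) χ.symm z := by
      have := mdifferentiableWithinAt_extChartAt_symm (I := 𝓘(ℝ, E)) hz
      rwa [hrange, mdifferentiableWithinAt_univ] at this
    have h₁ := mfderiv_comp_apply z hg hs (rep Z z)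
    have h₂ : mfderiv 𝓘(ℝ, E) 𝓘(ℝ, E) χ.symm z (rep Z z) = Z (χ.symm z) := by
      have := (isInvertible_mfderivWithin_extChartAt_symm (I := 𝓘(ℝ, E)) hz).self_apply_inverse
        (Z (χ.symm z))
      have h₃ : mfderivWithin 𝓘(ℝ, E) 𝓘(ℝ, E) χ.symm (Set.range 𝓘(ℝ, E)) z =
        mfderiv 𝓘(ℝ, E) 𝓘(ℝ, E) χ.symm z := by rw [hrange, mfderivWithin_univ]
      rw [← h₃]
      exact this
    rw [h₂, mfderiv_eq_fderiv] at h₁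
    exact h₁
  have hdiff {Z : VField E M} (hZ : IsCrAt r Z q) : DifferentiableAt ℝ (rep Z) z₀ := by
    have h₁ : MDifferentiableWithinAt 𝓘(ℝ, E) (𝓘(ℝ, E)).tangent
        (fun x ↦ (⟨x, Z x⟩ : TangentBundle 𝓘(ℝ, E) M)) Set.univ q :=
      (hZ.mdifferentiableAt hr0).mdifferentiableWithinAt
    have h₂ : DifferentiableWithinAt ℝ (rep Z)
        (χ.symm ⁻¹' Set.univ ∩ Set.range 𝓘(ℝ, E)) z₀ :=
      h₁.differentiableWithinAt_mpullbackWithin_vectorField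
    rwa [hrange, Set.preimage_univ, Set.univ_inter, differentiableWithinAt_univ] at h₂
  let ψ : E → F := fun z ↦ φ (χ.symm z)
  have hψ : ContDiffAt ℝ 2 ψ z₀ := by
    have h₁ : ContMDiffAt 𝓘(ℝ, E) 𝓘(ℝ, E) r χ.symm z₀ :=
      (contMDiffOn_extChartAt_symm q).contMDiffAt htarget
    have h₂ : ContMDiffAt 𝓘(ℝ, E) 𝓘(ℝ, F) r φ (χ.symm z₀) := by
      rw [hz]; exact hφ.self_of_nhds
    exact (h₂.comp z₀ h₁).contDiffAt.of_le hr2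
  have hdir {Z : VField E M} : (fun z ↦ dirDeriv Z φ (χ.symm z)) =ᶠ[𝓝 z₀]
      fun z ↦ fderiv ℝ ψ z (rep Z z) := by
    filter_upwards [htarget, hsymm.eventually hφ] with z hz hφz
    exact (hrep hz (hφz.mdifferentiableAt hr0) Z).symm
  have hψ' : HasFDerivAt (fderiv ℝ ψ) (fderiv ℝ (fderiv ℝ ψ) z₀) z₀ :=
    ((hψ.fderiv_right (m := 1) (by norm_num)).differentiableAt one_ne_zero).hasFDerivAt
  have hsec {Z Z' : VField E M} (hZ : IsCrAt r Z q) :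
      dirDeriv Z' (dirDeriv Z φ) q = fderiv ℝ (fderiv ℝ ψ) z₀ (rep Z' z₀) (rep Z z₀) +
        fderiv ℝ ψ z₀ (fderiv ℝ (rep Z) z₀ (rep Z' z₀)) := by
    have h₁ := hrep (g := dirDeriv Z φ) (z := z₀) (mem_extChartAt_target q)
      (by rw [hz]; exact (contMDiffAt_dirDeriv hr hZ hφ.self_of_nhds).mdifferentiableAt hr0) Z'
    rw [hz] at h₁
    rw [← h₁, hdir.fderiv_eq, (hψ'.clm_apply (hdiff hZ).hasFDerivAt).fderiv]
    simp [add_comm]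
  rw [hsec hX, hsec hY]
  have hbr : dirDeriv (VectorField.mlieBracket 𝓘(ℝ, E) X Y) φ q =
      fderiv ℝ ψ z₀ (VectorField.lieBracket ℝ (rep X) (rep Y) z₀) := by
    have h₁ : MDifferentiableAt 𝓘(ℝ, E) 𝓘(ℝ, E) χ q :=
      mdifferentiableAt_extChartAt (mem_chart_source E q)
    have h₂ : φ =ᶠ[𝓝 q] fun q' ↦ ψ (χ q') := by
      filter_upwards [extChartAt_source_mem_nhds (I := 𝓘(ℝ, E)) q] with q' hq'
      exact congrArg φ ((χ.left_inv hq').symm)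
    rw [dirDeriv_congr h₂, dirDeriv_comp (φ := (χ : M → E)) (g := ψ) (hψ.differentiableAt two_ne_zero) h₁]
    congr 1
    have h₃ := (isInvertible_mfderiv_extChartAt (I := 𝓘(ℝ, E))
      (mem_extChartAt_source (I := 𝓘(ℝ, E)) q)).self_apply_inverse
      (VectorField.lieBracketWithin (E := E) ℝ (rep X) (rep Y)
        (χ.symm ⁻¹' Set.univ ∩ Set.range 𝓘(ℝ, E)) z₀)
    refine Eq.trans ?_ (h₃.trans ?_)
    · rfl
    · rw [hrange, Set.preimage_univ, Set.univ_inter, VectorField.lieBracketWithin_univ]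
  rw [hbr, VectorField.lieBracket_eq, map_sub, hψ.isSymmSndFDerivAt (by simp) (rep X z₀) (rep Y z₀)]
  abel

end DirectionalDerivative

/-! ### Local coordinates -/

section LocalCoordinates

variable {E : Type*} [NormedAddCommGroup E] [NormedSpace ℝ E]
  {M : Type*} [TopologicalSpace M] [ChartedSpace E M]
  {Z : Type*} [NormedAddCommGroup Z] [NormedSpace ℝ Z]
  {F : Type*} [NormedAddCommGroup F] [NormedSpace ℝ F]

/-- `ζ` is a `C^r` coordinate system near `p` centred at `p`, with inverse `ζi`. Only the germs of
`ζ` at `p` and of `ζi` at `0` matter. -/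
structure IsLocalCoord (r : ℕ∞ω) (p : M) (ζ : M → Z) (ζi : Z → M) : Prop where
  map_base : ζ p = 0
  left_inv : ∀ᶠ q in 𝓝 p, ζi (ζ q) = q
  right_inv : ∀ᶠ z in 𝓝 0, ζ (ζi z) = z
  contMDiffAt : ∀ᶠ q in 𝓝 p, ContMDiffAt 𝓘(ℝ, E) 𝓘(ℝ, Z) r ζ q
  contMDiffAt_inv : ∀ᶠ z in 𝓝 0, ContMDiffAt 𝓘(ℝ, Z) 𝓘(ℝ, E) r ζi z

namespace IsLocalCoord

variable {r : ℕ∞ω} {p : M} {ζ : M → Z} {ζi : Z → M}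

theorem inv_zero (h : IsLocalCoord (E := E) r p ζ ζi) : ζi 0 = p := by
  have := h.left_inv.self_of_nhds
  rwa [h.map_base] at this

theorem tendsto (h : IsLocalCoord (E := E) r p ζ ζi) : Filter.Tendsto ζ (𝓝 p) (𝓝 0) := by
  have := h.contMDiffAt.self_of_nhds.continuousAt.tendsto
  rwa [h.map_base] at this

theorem tendsto_inv (h : IsLocalCoord (E := E) r p ζ ζi) : Filter.Tendsto ζi (𝓝 0) (𝓝 p) := by
  have := h.contMDiffAt_inv.self_of_nhds.continuousAt.tendsto
  rwa [h.inv_zero] at this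

theorem eventually_contDiffAt_comp_inv (h : IsLocalCoord (E := E) r p ζ ζi) {φ : M → F}
    (hφ : ∀ᶠ q in 𝓝 p, ContMDiffAt 𝓘(ℝ, E) 𝓘(ℝ, F) r φ q) :
    ∀ᶠ z in 𝓝 0, ContDiffAt ℝ r (fun z ↦ φ (ζi z)) z := by
  filter_upwards [h.tendsto_inv.eventually hφ, h.contMDiffAt_inv] with z h₁ h₂
  exact (h₁.comp z h₂).contDiffAt

theorem eventually_contMDiffAt_comp (h : IsLocalCoord (E := E) r p ζ ζi) {g : Z → F}
    (hg : ∀ᶠ z in 𝓝 0, ContDiffAt ℝ r g z) :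
    ∀ᶠ q in 𝓝 p, ContMDiffAt 𝓘(ℝ, E) 𝓘(ℝ, F) r (fun q ↦ g (ζ q)) q := by
  filter_upwards [h.tendsto.eventually hg, h.contMDiffAt] with q h₁ h₂
  exact h₁.contMDiffAt.comp q h₂

theorem eventually_injective (h : IsLocalCoord (E := E) r p ζ ζi) (hr : r ≠ 0) :
    ∀ᶠ q in 𝓝 p, ∀ v : TangentSpace 𝓘(ℝ, E) q, mvfderiv 𝓘(ℝ, E) ζ q v = 0 → v = 0 := by
  filter_upwards [h.left_inv.eventually_nhds, h.contMDiffAt, h.tendsto.eventually h.contMDiffAt_inv]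
    with q h₁ h₂ h₃ v hv
  have h₄ := mfderiv_comp_apply q (h₃.mdifferentiableAt hr) (h₂.mdifferentiableAt hr) v
  have h₅ : mfderiv 𝓘(ℝ, E) 𝓘(ℝ, E) (ζi ∘ ζ) q = mfderiv 𝓘(ℝ, E) 𝓘(ℝ, E) id q :=
    Filter.EventuallyEq.mfderiv_eq h₁
  have h₆ : mfderiv 𝓘(ℝ, E) 𝓘(ℝ, Z) ζ q v = 0 := hv
  have h₇ : mfderiv 𝓘(ℝ, E) 𝓘(ℝ, E) (ζi ∘ ζ) q v = v := by
    rw [h₅, mfderiv_id]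
    rfl
  rw [h₆] at h₄
  refine h₇.symm.trans (h₄.trans ?_)
  exact map_zero (mfderiv 𝓘(ℝ, Z) 𝓘(ℝ, E) ζi (ζ q))

theorem comp_openPartialHomeomorph (h : IsLocalCoord (E := E) r p ζ ζi)
    {Θ : OpenPartialHomeomorph Z Z} (h0 : 0 ∈ Θ.source) (hΘ0 : Θ 0 = 0)
    (hΘ : ∀ᶠ z in 𝓝 0, ContDiffAt ℝ r Θ z) (hΘs : ∀ᶠ z in 𝓝 0, ContDiffAt ℝ r Θ.symm z) :
    IsLocalCoord (E := E) r p (fun q ↦ Θ (ζ q)) (fun z ↦ ζi (Θ.symm z)) := by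
  have ht : (0 : Z) ∈ Θ.target := by have := Θ.map_source h0; rwa [hΘ0] at this
  have hs0 : Θ.symm 0 = 0 := by have := Θ.left_inv h0; rwa [hΘ0] at this
  have hst : Filter.Tendsto Θ.symm (𝓝 0) (𝓝 0) := by
    have := (Θ.symm.continuousAt (x := 0) (by simpa using ht)).tendsto
    rwa [hs0] at this
  refine ⟨by rw [h.map_base, hΘ0], ?_, ?_, h.eventually_contMDiffAt_comp hΘ, ?_⟩
  · filter_upwards [h.left_inv, h.tendsto.eventually (Θ.open_source.mem_nhds h0)] with q h₁ h₂
    rw [Θ.left_inv h₂, h₁]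
  · filter_upwards [hst.eventually h.right_inv, Θ.open_target.mem_nhds ht] with z h₁ h₂
    rw [h₁, Θ.right_inv h₂]
  · filter_upwards [hst.eventually h.contMDiffAt_inv, hΘs] with z h₁ h₂
    exact h₁.comp z h₂.contMDiffAt

end IsLocalCoord

theorem isLocalCoord_chart {r : ℕ∞ω} [IsManifold 𝓘(ℝ, E) r M] (p : M) (L : E ≃L[ℝ] Z) :
    IsLocalCoord (E := E) r p (fun q ↦ L (extChartAt 𝓘(ℝ, E) p q - extChartAt 𝓘(ℝ, E) p p))
      (fun z ↦ (extChartAt 𝓘(ℝ, E) p).symm (L.symm z + extChartAt 𝓘(ℝ, E) p p)) := by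
  have ht : Filter.Tendsto (fun z : Z ↦ L.symm z + extChartAt 𝓘(ℝ, E) p p) (𝓝 0)
      (𝓝 (extChartAt 𝓘(ℝ, E) p p)) := by
    have : Continuous fun z : Z ↦ L.symm z + extChartAt 𝓘(ℝ, E) p p := by fun_prop
    simpa using this.tendsto 0
  refine ⟨by simp, ?_, ?_, ?_, ?_⟩
  · filter_upwards [extChartAt_source_mem_nhds (I := 𝓘(ℝ, E)) p] with q hq
    rw [L.symm_apply_apply, sub_add_cancel]
    exact (extChartAt 𝓘(ℝ, E) p).left_inv hq
  · filter_upwards [ht.eventually (extChartAt_target_mem_nhds (I := 𝓘(ℝ, E)) p)] with z hz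
    rw [(extChartAt 𝓘(ℝ, E) p).right_inv hz]
    simp
  · filter_upwards [(chartAt E p).open_source.mem_nhds (mem_chart_source E p)] with q hq
    have h₁ : ContDiff ℝ r fun x : E ↦ L (x - extChartAt 𝓘(ℝ, E) p p) := by fun_prop
    exact h₁.contMDiff.contMDiffAt.comp q (contMDiffAt_extChartAt' hq)
  · filter_upwards [ht.eventually (isOpen_extChartAt_target (I := 𝓘(ℝ, E)) p |>.mem_nhds
      (mem_extChartAt_target p))] with z hz
    exact ((contMDiffOn_extChartAt_symm p).contMDiffAt
      ((isOpen_extChartAt_target (I := 𝓘(ℝ, E)) p).mem_nhds hz)).comp z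
      (by fun_prop : ContDiff ℝ r fun z : Z ↦ L.symm z + extChartAt 𝓘(ℝ, E) p p).contMDiff.contMDiffAt

/-- A linear isomorphism with a product of coordinate spaces under which a basis of the subspace
`D` becomes the standard basis of the first factor. -/
theorem exists_splitting {E : Type*} [NormedAddCommGroup E] [NormedSpace ℝ E]
    [FiniteDimensional ℝ E] {k : ℕ} {D : Submodule ℝ E} (b : Module.Basis (Fin k) ℝ D) :
    ∃ (l : ℕ) (L : E ≃L[ℝ] (Fin k → ℝ) × (Fin l → ℝ)), ∀ i, L (b i) = (Pi.single i 1, 0) := by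
  obtain ⟨C, hC⟩ := D.exists_isCompl
  let e : E ≃ₗ[ℝ] (Fin k → ℝ) × (Fin (Module.finrank ℝ C) → ℝ) :=
    (Submodule.prodEquivOfIsCompl D C hC).symm.trans
      (b.equivFun.prodCongr (Module.finBasis ℝ C).equivFun)
  refine ⟨_, e.toContinuousLinearEquiv, fun i ↦ ?_⟩
  have h : e (b i) = (b.equivFun (b i), (Module.finBasis ℝ C).equivFun 0) :=
    congrArg (b.equivFun.prodCongr (Module.finBasis ℝ C).equivFun)
      (Submodule.prodEquivOfIsCompl_symm_apply_left D C hC (b i))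
  rw [LinearEquiv.coe_toContinuousLinearEquiv', h, map_zero]
  congr 1
  ext j
  rw [Module.Basis.equivFun_self, Pi.single_apply]
  simp [eq_comm]

/-- Coordinates in which a given basis of a subspace of `T_p M` is at `p` the standard one. -/
theorem exists_isLocalCoord_of_basis [FiniteDimensional ℝ E] [IsManifold 𝓘(ℝ, E) ∞ M] {r : ℕ∞ω}
    [IsManifold 𝓘(ℝ, E) r M] (p : M) {k : ℕ}
    {D : Submodule ℝ (TangentSpace 𝓘(ℝ, E) p)} (b : Module.Basis (Fin k) ℝ D) :
    ∃ (l : ℕ) (ζ : M → (Fin k → ℝ) × (Fin l → ℝ)) (ζi : (Fin k → ℝ) × (Fin l → ℝ) → M),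
      IsLocalCoord (E := E) r p ζ ζi ∧ ∀ i,
        mvfderiv 𝓘(ℝ, E) ζ p (b i : TangentSpace 𝓘(ℝ, E) p) = (Pi.single i 1, 0) := by
  obtain ⟨l, L, hL⟩ := exists_splitting (E := E) (D := D) b
  obtain ⟨A, hA⟩ := isInvertible_mfderiv_extChartAt (I := 𝓘(ℝ, E))
    (mem_extChartAt_source (I := 𝓘(ℝ, E)) p)
  let A' : E ≃L[ℝ] E := A
  let L' : E ≃L[ℝ] (Fin k → ℝ) × (Fin l → ℝ) := A'.symm.trans L
  refine ⟨l, _, _, isLocalCoord_chart p L', fun i ↦ ?_⟩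
  have hχ : MDifferentiableAt 𝓘(ℝ, E) 𝓘(ℝ, E) (extChartAt 𝓘(ℝ, E) p) p :=
    mdifferentiableAt_extChartAt (mem_chart_source E p)
  let w : E := (b i).1
  have h₁ := dirDeriv_comp (X := fun _ ↦ w) (φ := (extChartAt 𝓘(ℝ, E) p : M → E))
    (g := fun x : E ↦ L' (x - extChartAt 𝓘(ℝ, E) p p)) (q := p) (by fun_prop) hχ
  have h₂ : fderiv ℝ (fun x : E ↦ L' (x - extChartAt 𝓘(ℝ, E) p p)) (extChartAt 𝓘(ℝ, E) p p) =
      (L' : E →L[ℝ] _) :=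
    ((L'.hasFDerivAt (x := _)).comp _ ((hasFDerivAt_id _).sub_const _)).fderiv
  have h₃ : dirDeriv (E := E) (fun _ ↦ w) (extChartAt 𝓘(ℝ, E) p : M → E) p = A' w :=
    (congrArg (fun B : E →L[ℝ] E ↦ B w) hA).symm
  rw [h₂, h₃] at h₁
  refine h₁.trans ?_
  have h₄ : L' (A' w) = L w := by simp [L']
  exact h₄.trans (hL i)

end LocalCoordinates

/-! ### Coordinates adapted to an involutive distribution -/

section AdaptedCoordinates

variable {E : Type*} [NormedAddCommGroup E] [NormedSpace ℝ E]
  {M : Type*} [TopologicalSpace M] [ChartedSpace E M]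
  {F : Type*} [NormedAddCommGroup F] [NormedSpace ℝ F]

theorem dirDeriv_add (X Y : VField E M) (φ : M → F) (q : M) :
    dirDeriv (fun q ↦ X q + Y q) φ q = dirDeriv X φ q + dirDeriv Y φ q :=
  map_add (mvfderiv 𝓘(ℝ, E) φ q) _ _

theorem dirDeriv_sum_smul {ι : Type*} [Fintype ι] (c : ι → M → ℝ) (X : ι → VField E M) (φ : M → F)
    (q : M) :
    dirDeriv (fun q ↦ ∑ i, c i q • X i q) φ q = ∑ i, c i q • dirDeriv (X i) φ q := by
  change mvfderiv 𝓘(ℝ, E) φ q (∑ i, c i q • X i q) = _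
  rw [map_sum]
  exact Finset.sum_congr rfl fun i _ ↦ map_smul _ _ _

variable [IsManifold 𝓘(ℝ, E) ∞ M]

theorem isCrAt_add {r : ℕ∞ω} (hr : r = ∞ ∨ r = ω) [IsManifold 𝓘(ℝ, E) r M] {X Y : VField E M}
    {q : M} (hX : IsCrAt r X q) (hY : IsCrAt r Y q) : IsCrAt r (fun q ↦ X q + Y q) q := by
  have := contMDiffVectorBundle_tangent (M := M) (E := E) hr
  exact ContMDiffAt.add_section hX hY

theorem isCrAt_sum_smul {r : ℕ∞ω} (hr : r = ∞ ∨ r = ω) [IsManifold 𝓘(ℝ, E) r M] {ι : Type*}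
    [Fintype ι] {c : ι → M → ℝ} {X : ι → VField E M} {q : M}
    (hc : ∀ i, ContMDiffAt 𝓘(ℝ, E) 𝓘(ℝ, ℝ) r (c i) q) (hX : ∀ i, IsCrAt r (X i) q) :
    IsCrAt r (fun q ↦ ∑ i, c i q • X i q) q := by
  have := contMDiffVectorBundle_tangent (M := M) (E := E) hr
  exact ContMDiffAt.sum_section fun i _ ↦ ContMDiffAt.smul_section (hc i) (hX i)

theorem isCrAt_of_mem_sections {r : ℕ∞ω} {D : GenDistribution E M} {U : Set M} (hU : IsOpen U)
    {X : VField E M} (hX : X ∈ sections r U D) {q : M} (hq : q ∈ U) : IsCrAt r X q :=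
  (hX.1 q hq).contMDiffAt (hU.mem_nhds hq)

/-- A regular distribution has near `p` a frame consisting of sections over a prescribed small
neighbourhood, together with coordinates in which the frame is standard at `p`. -/
theorem exists_frame [FiniteDimensional ℝ E] {r : ℕ∞ω} [IsManifold 𝓘(ℝ, E) r M]
    {D : GenDistribution E M} {p : M} {U : Set M} (hU : IsSmallNhd r D p U) :
    ∃ (k l : ℕ) (X : Fin k → VField E M) (ζ : M → (Fin k → ℝ) × (Fin l → ℝ))
      (ζi : (Fin k → ℝ) × (Fin l → ℝ) → M), Module.finrank ℝ (D p) = k ∧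
      (∀ i, X i ∈ sections r U D) ∧ IsLocalCoord (E := E) r p ζ ζi ∧
      ∀ i, dirDeriv (X i) ζ p = (Pi.single i 1, 0) := by
  have : FiniteDimensional ℝ (TangentSpace 𝓘(ℝ, E) p) := inferInstanceAs (FiniteDimensional ℝ E)
  let b := Module.finBasis ℝ (D p)
  obtain ⟨l, ζ, ζi, hζ, hb⟩ := exists_isLocalCoord_of_basis (r := r) p b
  choose X hX hXp using fun i ↦ hU.exists_section (b i) (b i).2
  refine ⟨_, l, X, ζ, ζi, rfl, hX, hζ, fun i ↦ ?_⟩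
  rw [dirDeriv, hXp]
  exact hb i

/-- Linearly independent vectors of the right number span. -/
theorem exists_eq_sum_smul {V : Type*} [AddCommGroup V] [Module ℝ V] [FiniteDimensional ℝ V] {k : ℕ}
    {D : Submodule ℝ V} (hk : Module.finrank ℝ D = k) {X : Fin k → V} (hX : ∀ i, X i ∈ D)
    (hind : ∀ s : Fin k → ℝ, ∑ i, s i • X i = 0 → s = 0) {w : V} (hw : w ∈ D) :
    ∃ s : Fin k → ℝ, ∑ i, s i • X i = w := by
  let f : (Fin k → ℝ) →ₗ[ℝ] D :=
    { toFun := fun s ↦ ⟨∑ i, s i • X i, D.sum_mem fun i _ ↦ D.smul_mem _ (hX i)⟩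
      map_add' := fun s t ↦ by ext; simp [add_smul, Finset.sum_add_distrib]
      map_smul' := fun c s ↦ by ext; simp [Finset.smul_sum, smul_smul] }
  have hf : Function.Injective f := (injective_iff_map_eq_zero f).2 fun s hs ↦
    hind s (congrArg Subtype.val hs)
  obtain ⟨s, hs⟩ := (LinearMap.injective_iff_surjective_of_finrank_eq_finrank (by simp [hk])).1 hf
    ⟨w, hw⟩
  exact ⟨s, congrArg Subtype.val hs⟩

/-- In suitable coordinates, an involutive distribution is near `p` the span of the first `k`
coordinate fields. A frame of the distribution by sections over a prescribed small neighbourhood is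
also given, and `σ` expresses the coordinate fields in terms of this frame. -/
theorem exists_adapted_coordinates [FiniteDimensional ℝ E] {r : ℕ∞ω} (hr : r = ∞ ∨ r = ω)
    [IsManifold 𝓘(ℝ, E) r M] {D : GenDistribution E M} (hreg : IsRegularDistribution r D)
    (hinv : IsInvolutive r D) {p : M} {U : Set M} (hU : IsSmallNhd r D p U) :
    ∃ (k l : ℕ) (X : Fin k → VField E M) (θ : M → (Fin k → ℝ) × (Fin l → ℝ))
      (θi : (Fin k → ℝ) × (Fin l → ℝ) → M)
      (σ : (Fin k → ℝ) × (Fin l → ℝ) → (Fin k → ℝ) →L[ℝ] (Fin k → ℝ)),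
      (∀ i, X i ∈ sections r U D) ∧ IsLocalCoord (E := E) r p θ θi ∧
      (∀ᶠ z in 𝓝 0, ContDiffAt ℝ r σ z) ∧
      (∀ᶠ q in 𝓝 p, ∀ w, w ∈ D q ↔ (mvfderiv 𝓘(ℝ, E) θ q w).2 = 0) ∧
      ∀ᶠ q in 𝓝 p, ∀ v, ∑ i, σ (θ q) v i • dirDeriv (X i) θ q = (v, 0) := by
  have hr0 : r ≠ 0 := by rcases hr with rfl | rfl <;> simp
  obtain ⟨k, l, X, ζ, ζi, hk, hX, hζ, hXp⟩ := exists_frame hU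
  have hUp : ∀ᶠ q in 𝓝 p, q ∈ U := hU.isOpen.mem_nhds hU.mem
  have hXζ (i : Fin k) :
      ∀ᶠ q in 𝓝 p, ContMDiffAt 𝓘(ℝ, E) 𝓘(ℝ, (Fin k → ℝ) × (Fin l → ℝ)) r
        (dirDeriv (X i) ζ) q := by
    filter_upwards [hUp, hζ.contMDiffAt] with q hq hζq
    exact contMDiffAt_dirDeriv hr (isCrAt_of_mem_sections hU.isOpen (hX i) hq) hζq
  -- the frame in coordinates, and its horizontal part
  let A : (Fin k → ℝ) × (Fin l → ℝ) → (Fin k → ℝ) →L[ℝ] (Fin k → ℝ) × (Fin l → ℝ) := fun z ↦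
    ∑ i, (ContinuousLinearMap.proj (R := ℝ) (φ := fun _ : Fin k ↦ ℝ) i).smulRight
      (dirDeriv (X i) ζ (ζi z))
  have hA (z) (s : Fin k → ℝ) : A z s = ∑ i, s i • dirDeriv (X i) ζ (ζi z) := by
    simp [A]
  have hAc : ∀ᶠ z in 𝓝 0, ContDiffAt ℝ r A z := by
    have h₁ : ∀ᶠ z in 𝓝 0, ∀ i, ContDiffAt ℝ r (fun z ↦ dirDeriv (X i) ζ (ζi z)) z :=
      Filter.eventually_all.2 fun i ↦ hζ.eventually_contDiffAt_comp_inv (hXζ i)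
    filter_upwards [h₁] with z hz
    exact ContDiffAt.sum fun i _ ↦ contDiffAt_const.smulRight (hz i)
  let T : (Fin k → ℝ) × (Fin l → ℝ) → (Fin k → ℝ) →L[ℝ] (Fin k → ℝ) := fun z ↦
    (ContinuousLinearMap.fst ℝ _ _).comp (A z)
  have hTc : ∀ᶠ z in 𝓝 0, ContDiffAt ℝ r T z :=
    hAc.mono fun z hz ↦ contDiffAt_const.clm_comp hz
  have hT0 : T 0 = ContinuousLinearEquiv.refl ℝ (Fin k → ℝ) := by
    refine ContinuousLinearMap.ext fun s ↦ ?_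
    simp only [T, ContinuousLinearMap.comp_apply, hA, hζ.inv_zero, hXp]
    ext j
    simp [Finset.sum_apply, Pi.single_apply]
  have hTinv : ∀ᶠ z in 𝓝 0, ∃ e : (Fin k → ℝ) ≃L[ℝ] (Fin k → ℝ), T z = e := by
    have h₁ := hTc.self_of_nhds.continuousAt.tendsto
    rw [hT0] at h₁
    exact (h₁.eventually (ContinuousLinearEquiv.refl ℝ (Fin k → ℝ)).nhds).mono
      fun z ⟨e, he⟩ ↦ ⟨e, he.symm⟩
  let S : (Fin k → ℝ) × (Fin l → ℝ) → (Fin k → ℝ) →L[ℝ] (Fin k → ℝ) := fun z ↦ (T z).inverse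
  have hSc : ∀ᶠ z in 𝓝 0, ContDiffAt ℝ r S z := by
    filter_upwards [hTc, hTinv] with z hz ⟨e, he⟩
    have h₁ : ContDiffAt ℝ r ContinuousLinearMap.inverse (T z) := by
      rw [he]; exact contDiffAt_map_inverse e
    exact h₁.comp z hz
  have hTS : ∀ᶠ z in 𝓝 0, (∀ v, T z (S z v) = v) ∧ ∀ v, S z (T z v) = v := by
    filter_upwards [hTinv] with z ⟨e, he⟩
    simp [S, he]
  let b : (Fin k → ℝ) × (Fin l → ℝ) → (Fin k → ℝ) →L[ℝ] (Fin l → ℝ) := fun z ↦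
    ((ContinuousLinearMap.snd ℝ _ _).comp (A z)).comp (S z)
  have hbc : ∀ᶠ z in 𝓝 0, ContDiffAt ℝ r b z := by
    filter_upwards [hAc, hSc] with z h₁ h₂
    exact (contDiffAt_const.clm_comp h₁).clm_comp h₂
  have hAS : ∀ᶠ z in 𝓝 0, ∀ v, A z (S z v) = (v, b z v) :=
    hTS.mono fun z hz v ↦ Prod.ext (hz.1 v) rfl
  have hAT : ∀ᶠ z in 𝓝 0, ∀ s, A z s = (T z s, b z (T z s)) :=
    hTS.mono fun z hz s ↦ Prod.ext rfl (by simp [b, hz.2])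
  -- the vectors of `D`, in coordinates, form the graph of `b`
  have hgraph : ∀ᶠ q in 𝓝 p, ∀ w ∈ D q, (mvfderiv 𝓘(ℝ, E) ζ q w).2 =
      b (ζ q) (mvfderiv 𝓘(ℝ, E) ζ q w).1 := by
    filter_upwards [hUp, hreg.rank_locally_constant p, hζ.tendsto.eventually hTS,
      hζ.tendsto.eventually hAT, hζ.left_inv] with q hq hrank hTSq hATq hl w hw
    have : FiniteDimensional ℝ (TangentSpace 𝓘(ℝ, E) q) := inferInstanceAs (FiniteDimensional ℝ E)
    have hAq (s : Fin k → ℝ) : mvfderiv 𝓘(ℝ, E) ζ q (∑ i, s i • X i q) = A (ζ q) s := by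
      rw [hA, hl, map_sum]
      exact Finset.sum_congr rfl fun i _ ↦ map_smul _ _ _
    have hind (s : Fin k → ℝ) (hs : ∑ i, s i • X i q = 0) : s = 0 := by
      have h₁ := hAq s
      rw [hs, map_zero, hATq] at h₁
      have h₂ : T (ζ q) s = 0 := (congrArg Prod.fst h₁).symm
      rw [← hTSq.2 s, h₂, map_zero]
    obtain ⟨s, rfl⟩ := exists_eq_sum_smul (hrank.trans hk) (fun i ↦ (hX i).2 q hq) hind hw
    rw [hAq, hATq]
  -- the sections of `D` with constant horizontal part
  let e : (Fin k → ℝ) → VField E M := fun v q ↦ ∑ i, S (ζ q) v i • X i q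
  have heD : ∀ᶠ q in 𝓝 p, ∀ v, e v q ∈ D q := by
    filter_upwards [hUp] with q hq v
    exact (D q).sum_mem fun i _ ↦ (D q).smul_mem _ ((hX i).2 q hq)
  have hec : ∀ᶠ q in 𝓝 p, ∀ v, IsCrAt r (e v) q := by
    filter_upwards [hUp, hζ.tendsto.eventually hSc, hζ.contMDiffAt] with q hq hSq hζq v
    refine isCrAt_sum_smul hr (fun i ↦ ?_) fun i ↦ isCrAt_of_mem_sections hU.isOpen (hX i) hq
    have h₁ : ContDiffAt ℝ r (fun z ↦ S z v i) (ζ q) :=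
      (ContinuousLinearMap.proj (R := ℝ) (φ := fun _ : Fin k ↦ ℝ) i).contDiff.contDiffAt.comp _
        (hSq.clm_apply contDiffAt_const)
    exact h₁.contMDiffAt.comp q hζq
  have heζ : ∀ᶠ q in 𝓝 p, ∀ v, dirDeriv (e v) ζ q = (v, b (ζ q) v) := by
    filter_upwards [hζ.tendsto.eventually hAS, hζ.left_inv] with q hq hl v
    have h₁ := dirDeriv_sum_smul (fun i q ↦ S (ζ q) v i) X ζ q
    refine h₁.trans ?_
    rw [← hq v, hA, hl]
  -- involutivity is the integrability condition
  have hint : ∀ᶠ q in 𝓝 p, ∀ v v', fderiv ℝ b (ζ q) (v, b (ζ q) v) v' =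
      fderiv ℝ b (ζ q) (v', b (ζ q) v') v := by
    obtain ⟨U₁, hU₁, hU₁o, hpU₁⟩ := eventually_nhds_iff.1 (heD.and hec)
    filter_upwards [hU₁o.mem_nhds hpU₁, hgraph, hζ.contMDiffAt.eventually_nhds,
      heζ.eventually_nhds, hζ.tendsto.eventually hbc] with q hq hgr hζq heq hbq v v'
    have hes (v) : e v ∈ sections r U₁ D :=
      ⟨fun q hq ↦ ((hU₁ q hq).2 v).contMDiffWithinAt, fun q hq ↦ (hU₁ q hq).1 v⟩
    have h₁ := hgr _ ((hinv U₁ hU₁o _ (hes v) _ (hes v')).2 q hq)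
    have h₂ := dirDeriv_mlieBracket hr ((hU₁ q hq).2 v) ((hU₁ q hq).2 v') hζq
    have h₃ (v v') : dirDeriv (e v) (dirDeriv (e v') ζ) q =
        (0, fderiv ℝ b (ζ q) (v, b (ζ q) v) v') := by
      have h₄ : dirDeriv (e v') ζ =ᶠ[𝓝 q] fun q ↦ (v', b (ζ q) v') := heq.mono fun q hq ↦ hq v'
      have h₅ : HasFDerivAt (fun z ↦ (v', b z v')) _ (ζ q) :=
        (hasFDerivAt_const v' (ζ q)).prodMk
          ((hbq.differentiableAt hr0).hasFDerivAt.clm_apply (hasFDerivAt_const v' (ζ q)))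
      rw [dirDeriv_congr h₄, dirDeriv_comp (g := fun z ↦ (v', b z v')) h₅.differentiableAt
        (hζq.self_of_nhds.mdifferentiableAt hr0), h₅.fderiv, heq.self_of_nhds v]
      simp
    rw [h₃, h₃] at h₂
    rw [dirDeriv] at h₂
    rw [h₂] at h₁
    simpa [sub_eq_zero] using h₁
  obtain ⟨Θ, hΘ0, hΘz, hΘc, hΘs, hΘd⟩ := exists_straightening hr hbc
    ((hζ.tendsto_inv.eventually hint).and hζ.right_inv |>.mono fun z ⟨h₁, h₂⟩ ↦ by
      rwa [h₂] at h₁)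
  have hθ := hζ.comp_openPartialHomeomorph hΘ0 hΘz hΘc hΘs
  have hΘst : Filter.Tendsto Θ.symm (𝓝 0) (𝓝 0) := by
    have ht : (0 : (Fin k → ℝ) × (Fin l → ℝ)) ∈ Θ.target := by
      have := Θ.map_source hΘ0; rwa [hΘz] at this
    have hs0 : Θ.symm 0 = 0 := by have := Θ.left_inv hΘ0; rwa [hΘz] at this
    have := (Θ.symm.continuousAt (x := 0) (by simpa using ht)).tendsto
    rwa [hs0] at this
  have hθd : ∀ᶠ q in 𝓝 p, ∀ Y : VField E M, dirDeriv Y (fun q ↦ Θ (ζ q)) q =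
      fderiv ℝ Θ (ζ q) (dirDeriv Y ζ q) := by
    filter_upwards [hζ.tendsto.eventually hΘc, hζ.contMDiffAt] with q h₁ h₂ Y
    exact dirDeriv_comp (h₁.differentiableAt hr0) (h₂.mdifferentiableAt hr0)
  have heθ : ∀ᶠ q in 𝓝 p, ∀ v, dirDeriv (e v) (fun q ↦ Θ (ζ q)) q = (v, 0) := by
    filter_upwards [hθd, heζ, hζ.tendsto.eventually hΘd] with q h₁ h₂ h₃ v
    rw [h₁, h₂, h₃]
  refine ⟨k, l, X, _, _, fun z ↦ S (Θ.symm z), hX, hθ, ?_, ?_, ?_⟩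
  · filter_upwards [hΘst.eventually hSc, hΘs] with z h₁ h₂
    exact h₁.comp z h₂
  · filter_upwards [hgraph, hθd, heθ, heD, hζ.tendsto.eventually hΘd,
      hθ.eventually_injective hr0] with q hgr hd he heD hΘq hinj w
    constructor
    · intro hw
      have h₁ : mvfderiv 𝓘(ℝ, E) (fun q ↦ Θ (ζ q)) q w =
          fderiv ℝ Θ (ζ q) (mvfderiv 𝓘(ℝ, E) ζ q w) := hd fun _ ↦ w
      rw [h₁, ← Prod.mk.eta (p := mvfderiv 𝓘(ℝ, E) ζ q w), hgr w hw, hΘq]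
    · intro hw
      have h₁ : w - e (mvfderiv 𝓘(ℝ, E) (fun q ↦ Θ (ζ q)) q w).1 q = 0 := by
        refine hinj _ ?_
        rw [map_sub, sub_eq_zero]
        have h₂ : mvfderiv 𝓘(ℝ, E) (fun q ↦ Θ (ζ q)) q
            (e (mvfderiv 𝓘(ℝ, E) (fun q ↦ Θ (ζ q)) q w).1 q) = _ := he _
        rw [h₂]
        exact Prod.ext rfl hw
      rw [sub_eq_zero.1 h₁]
      exact heD _
  · filter_upwards [heθ, hζ.tendsto.eventually (Θ.open_source.mem_nhds hΘ0)] with q hq hs v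
    rw [Θ.left_inv hs, ← hq v]
    exact (dirDeriv_sum_smul (fun i q ↦ S (ζ q) v i) X (fun q ↦ Θ (ζ q)) q).symm

end AdaptedCoordinates

/-! ### Brackets and transverse components -/

section Brackets

variable {E : Type*} [NormedAddCommGroup E] [NormedSpace ℝ E]
  {M : Type*} [TopologicalSpace M] [ChartedSpace E M]
  {F : Type*} [NormedAddCommGroup F] [NormedSpace ℝ F]
  {G : Type*} [NormedAddCommGroup G] [NormedSpace ℝ G]

theorem dirDeriv_clm_comp {X : VField E M} {φ : M → F} (L : F →L[ℝ] G) {q : M}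
    (hφ : MDifferentiableAt 𝓘(ℝ, E) 𝓘(ℝ, F) φ q) :
    dirDeriv X (fun q' ↦ L (φ q')) q = L (dirDeriv X φ q) := by
  rw [dirDeriv_comp L.differentiableAt hφ, L.fderiv]

variable [IsManifold 𝓘(ℝ, E) ∞ M]

theorem isCrAt_mlieBracket [CompleteSpace E] {r : ℕ∞ω} (hr : r = ∞ ∨ r = ω)
    [IsManifold 𝓘(ℝ, E) r M] {X Y : VField E M} {q : M} (hX : IsCrAt r X q) (hY : IsCrAt r Y q) :
    IsCrAt r (VectorField.mlieBracket 𝓘(ℝ, E) X Y) q := by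
  have hr1 : r + 1 = r := by rcases hr with rfl | rfl <;> simp
  have : IsManifold 𝓘(ℝ, E) (r + 1) M := by rwa [hr1]
  have : IsManifold 𝓘(ℝ, E) (minSmoothness ℝ 2) M := by
    rw [minSmoothness_of_isRCLikeNormedField]; infer_instance
  have hX' := hX.contMDiffWithinAt (s := Set.univ)
  have hY' := hY.contMDiffWithinAt (s := Set.univ)
  have := ContMDiffWithinAt.mlieBracketWithin_vectorField (m := r) hX' hY' uniqueMDiffOn_univ
    (Set.mem_univ q) (by rcases hr with rfl | rfl <;> simp)
  rw [VectorField.mlieBracketWithin_univ] at this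
  exact this.contMDiffAt Filter.univ_mem

/-- The Leibniz rule for a combination of vector fields with functions as coefficients. -/
theorem mlieBracket_sum_smul_left [CompleteSpace E] {r : ℕ∞ω} (hr : r = ∞ ∨ r = ω)
    [IsManifold 𝓘(ℝ, E) r M] {ι : Type*} [Fintype ι] {c : ι → M → ℝ} {g : ι → VField E M}
    (X : VField E M) {q : M} (hc : ∀ i, ContMDiffAt 𝓘(ℝ, E) 𝓘(ℝ, ℝ) r (c i) q)
    (hg : ∀ i, IsCrAt r (g i) q) :
    VectorField.mlieBracket 𝓘(ℝ, E) (fun q ↦ ∑ i, c i q • g i q) X q =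
      ∑ i, c i q • VectorField.mlieBracket 𝓘(ℝ, E) (g i) X q - ∑ i, dirDeriv X (c i) q • g i q := by
  classical
  have hr0 : r ≠ 0 := by rcases hr with rfl | rfl <;> simp
  have := contMDiffVectorBundle_tangent (M := M) (E := E) hr
  have key (s : Finset ι) :
      VectorField.mlieBracket 𝓘(ℝ, E) (fun q ↦ ∑ i ∈ s, c i q • g i q) X q =
      ∑ i ∈ s, c i q • VectorField.mlieBracket 𝓘(ℝ, E) (g i) X q -
        ∑ i ∈ s, dirDeriv X (c i) q • g i q := by
    induction s using Finset.induction_on with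
    | empty =>
      have h : (fun q ↦ ∑ i ∈ (∅ : Finset ι), c i q • g i q : VField E M) = 0 := by
        ext; simp
      rw [h, VectorField.mlieBracket_zero_left]
      simp
    | insert i s hi ih =>
      have h : (fun q ↦ ∑ j ∈ insert i s, c j q • g j q : VField E M) =
          c i • g i + fun q ↦ ∑ j ∈ s, c j q • g j q := by
        ext q'
        rw [Finset.sum_insert hi]
        rfl
      have h₁ : IsCrAt r (c i • g i) q := ContMDiffAt.smul_section (hc i) (hg i)
      have h₂ : IsCrAt r (fun q ↦ ∑ j ∈ s, c j q • g j q) q :=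
        ContMDiffAt.sum_section fun j _ ↦ ContMDiffAt.smul_section (hc j) (hg j)
      rw [h, VectorField.mlieBracket_add_left (h₁.mdifferentiableAt hr0) (h₂.mdifferentiableAt hr0),
        ih, VectorField.mlieBracket_smul_left ((hc i).mdifferentiableAt hr0)
          ((hg i).mdifferentiableAt hr0), Finset.sum_insert hi, Finset.sum_insert hi, dirDeriv,
        neg_smul]
      abel
  exact key Finset.univ

/-- For a field `X` tangent to the fibres of the second component of `θ`, the bracket `[G, X]`
acts on that component as minus the derivative along `X` of the transverse part of `G`. -/
theorem snd_dirDeriv_mlieBracket [CompleteSpace E] {r : ℕ∞ω} (hr : r = ∞ ∨ r = ω)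
    [IsManifold 𝓘(ℝ, E) r M] {θ : M → F × G} {Y X : VField E M} {q : M}
    (hθ : ∀ᶠ q' in 𝓝 q, ContMDiffAt 𝓘(ℝ, E) 𝓘(ℝ, F × G) r θ q') (hY : IsCrAt r Y q)
    (hX : IsCrAt r X q) (hker : ∀ᶠ q' in 𝓝 q, (dirDeriv X θ q').2 = 0) :
    (dirDeriv (VectorField.mlieBracket 𝓘(ℝ, E) Y X) θ q).2 =
      -(dirDeriv X (dirDeriv Y θ) q).2 := by
  have hr0 : r ≠ 0 := by rcases hr with rfl | rfl <;> simp
  have h₁ : (dirDeriv Y (dirDeriv X θ) q).2 = 0 := by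
    have h₂ := dirDeriv_clm_comp (X := Y) (ContinuousLinearMap.snd ℝ F G)
      ((contMDiffAt_dirDeriv hr hX hθ.self_of_nhds).mdifferentiableAt hr0)
    refine Eq.trans h₂.symm (dirDeriv_of_eventually_eq_const hker)
  rw [dirDeriv_mlieBracket hr hY hX hθ, Prod.snd_sub, h₁, zero_sub]

end Brackets

/-! ### From a feedback to the bracket conditions -/

section Necessity

variable {E : Type*} [NormedAddCommGroup E] [NormedSpace ℝ E]
  {M : Type*} [TopologicalSpace M] [ChartedSpace E M]

theorem contMDiffOn_det {r : ℕ∞ω} {U : Set M} {m : ℕ} {A : M → Matrix (Fin m) (Fin m) ℝ}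
    (hA : ∀ i j, (fun q ↦ A q i j) ∈ functions E r U) :
    (fun q ↦ (A q).det) ∈ functions E r U := by
  simp only [functions, Set.mem_ofPred_eq] at hA ⊢
  simp only [Matrix.det_apply']
  exact contMDiffOn_finsetSum fun σ _ ↦ contMDiffOn_const.mul
    (contMDiffOn_finsetProd fun i _ ↦ hA _ _)

theorem contMDiffOn_matrix_inv {r : ℕ∞ω} {U : Set M} {m : ℕ} {A : M → Matrix (Fin m) (Fin m) ℝ}
    (hA : ∀ i j, (fun q ↦ A q i j) ∈ functions E r U) (hu : ∀ q ∈ U, IsUnit (A q)) (i j : Fin m) :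
    (fun q ↦ (A q)⁻¹ i j) ∈ functions E r U := by
  have h₁ : (fun q ↦ (A q).adjugate i j) ∈ functions E r U := by
    simp only [Matrix.adjugate_apply]
    refine contMDiffOn_det fun i' j' ↦ ?_
    by_cases h : i' = j
    · subst h
      simp only [Matrix.updateRow_self]
      exact contMDiffOn_const
    · simp only [Matrix.updateRow_ne h]
      exact hA i' j'
  have h₂ : (fun q ↦ ((A q).det)⁻¹) ∈ functions E r U := fun q hq ↦ by
    have h₃ : (A q).det ≠ 0 := ((Matrix.isUnit_iff_isUnit_det _).1 (hu q hq)).ne_zero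
    exact (contDiffAt_inv ℝ h₃).contMDiffAt.comp_contMDiffWithinAt q (contMDiffOn_det hA q hq)
  have h₃ : (fun q ↦ (A q)⁻¹ i j) = fun q ↦ ((A q).det)⁻¹ * (A q).adjugate i j := by
    ext q
    simp [Matrix.inv_def, Ring.inverse_eq_inv']
  rw [h₃]
  exact ContMDiffOn.mul h₂ h₁

variable [IsManifold 𝓘(ℝ, E) ∞ M]

theorem dirDeriv_mem_functions {r : ℕ∞ω} (hr : r = ∞ ∨ r = ω) [IsManifold 𝓘(ℝ, E) r M]
    {D : GenDistribution E M} {U : Set M} (hU : IsOpen U) {X : VField E M} (hX : X ∈ sections r U D)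
    {c : M → ℝ} (hc : c ∈ functions E r U) : dirDeriv X c ∈ functions E r U := fun _ hq ↦
  (contMDiffAt_dirDeriv hr (isCrAt_of_mem_sections hU hX hq)
    (hc.contMDiffAt (hU.mem_nhds hq))).contMDiffWithinAt

theorem sum_smul_mem_sections {r : ℕ∞ω} (hr : r = ∞ ∨ r = ω) [IsManifold 𝓘(ℝ, E) r M]
    {D : GenDistribution E M} {U : Set M} (hU : IsOpen U) {ι : Type*} [Fintype ι]
    {c : ι → M → ℝ} {Y : ι → VField E M} (hc : ∀ i, c i ∈ functions E r U)
    (hY : ∀ i, Y i ∈ sections r U D) : (fun q ↦ ∑ i, c i q • Y i q) ∈ sections r U D :=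
  ⟨fun _ hq ↦ (isCrAt_sum_smul hr (fun i ↦ (hc i).contMDiffAt (hU.mem_nhds hq))
      fun i ↦ isCrAt_of_mem_sections hU (hY i) hq).contMDiffWithinAt,
    fun q hq ↦ (D q).sum_mem fun i _ ↦ (D q).smul_mem _ ((hY i).2 q hq)⟩

theorem add_mem_sections {r : ℕ∞ω} (hr : r = ∞ ∨ r = ω) [IsManifold 𝓘(ℝ, E) r M]
    {D : GenDistribution E M} {U : Set M} (hU : IsOpen U) {X Y : VField E M}
    (hX : X ∈ sections r U D) (hY : Y ∈ sections r U D) :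
    (fun q ↦ X q + Y q) ∈ sections r U D :=
  ⟨fun _ hq ↦ (isCrAt_add hr (isCrAt_of_mem_sections hU hX hq)
    (isCrAt_of_mem_sections hU hY hq)).contMDiffWithinAt,
    fun q hq ↦ (D q).add_mem (hX.2 q hq) (hY.2 q hq)⟩

theorem AffineSystem.isCrAt_f {r : ℕ∞ω} {m : ℕ} (S : AffineSystem E M r m) (q : M) :
    IsCrAt r S.f q := (S.f_cr q trivial).contMDiffAt Filter.univ_mem

theorem AffineSystem.isCrAt_g {r : ℕ∞ω} {m : ℕ} (S : AffineSystem E M r m) (i : Fin m) (q : M) :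
    IsCrAt r (S.g i) q := (S.g_cr i q trivial).contMDiffAt Filter.univ_mem

variable [CompleteSpace E] {r : ℕ∞ω} {m : ℕ} {S : AffineSystem E M r m} {D : GenDistribution E M}
  {U : Set M} {α : M → Fin m → ℝ} {β : M → Matrix (Fin m) (Fin m) ℝ}

/-- If the fields `∑ j, β_ij g_j` leave `D` invariant, solving for `g` by means of `β⁻¹` shows
that the `g_i` do so up to combinations of the `g_j`. -/
theorem mlieBracket_g_mem (hr : r = ∞ ∨ r = ω) [IsManifold 𝓘(ℝ, E) r M] (hU : IsOpen U)
    (hfb : IsFeedback E r U α β)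
    (hg : ∀ i, ∀ X ∈ sections r U D,
      VectorField.mlieBracket 𝓘(ℝ, E) (S.feedbackControl β i) X ∈ sections r U D)
    {X : VField E M} (hX : X ∈ sections r U D) (i : Fin m) :
    VectorField.mlieBracket 𝓘(ℝ, E) (S.g i) X ∈ sectionsAddSpan r U D S.g := by
  have hinv (l : Fin m) : (fun q ↦ (β q)⁻¹ i l) ∈ functions E r U :=
    contMDiffOn_matrix_inv hfb.beta_cr hfb.beta_invertible i l
  refine ⟨_, sum_smul_mem_sections hr hU hinv fun l ↦ hg l X hX,
    fun j q ↦ ∑ l, (β q)⁻¹ i l * dirDeriv X (fun q ↦ β q l j) q, fun j ↦ ?_, fun q hq ↦ ?_⟩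
  · exact contMDiffOn_finsetSum fun l _ ↦
      ContMDiffOn.mul (hinv l) (dirDeriv_mem_functions hr hU hX (hfb.beta_cr l j))
  · have h₁ (l : Fin m) := mlieBracket_sum_smul_left hr (c := fun j q ↦ β q l j) (g := S.g) X
      (fun j ↦ (hfb.beta_cr l j).contMDiffAt (hU.mem_nhds hq)) (fun j ↦ S.isCrAt_g j q)
    have h₂ : (β q)⁻¹ * β q = 1 :=
      Matrix.nonsing_inv_mul _ ((Matrix.isUnit_iff_isUnit_det _).1 (hfb.beta_invertible q hq))
    have h₃ (j : Fin m) : ∑ l, (β q)⁻¹ i l * β q l j = if i = j then 1 else 0 := by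
      rw [← Matrix.mul_apply, h₂, Matrix.one_apply]
    unfold AffineSystem.feedbackControl
    simp only [h₁, smul_sub, Finset.sum_sub_distrib, Finset.smul_sum, smul_smul, Finset.sum_smul]
    rw [Finset.sum_comm (f := fun l j ↦ ((β q)⁻¹ i l * β q l j) •
      VectorField.mlieBracket 𝓘(ℝ, E) (S.g j) X q)]
    simp only [← Finset.sum_smul, h₃]
    rw [Finset.sum_comm (f := fun l j ↦ ((β q)⁻¹ i l * dirDeriv X (fun q ↦ β q l j) q) • S.g j q)]
    simp [Finset.sum_smul]

theorem mlieBracket_f_mem (hr : r = ∞ ∨ r = ω) [IsManifold 𝓘(ℝ, E) r M] (hU : IsOpen U)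
    (hfb : IsFeedback E r U α β)
    (hf : ∀ X ∈ sections r U D,
      VectorField.mlieBracket 𝓘(ℝ, E) (S.feedbackDrift α) X ∈ sections r U D)
    {X : VField E M} (hX : X ∈ sections r U D)
    (hg : ∀ i, VectorField.mlieBracket 𝓘(ℝ, E) (S.g i) X ∈ sectionsAddSpan r U D S.g) :
    VectorField.mlieBracket 𝓘(ℝ, E) S.f X ∈ sectionsAddSpan r U D S.g := by
  have hr0 : r ≠ 0 := by rcases hr with rfl | rfl <;> simp
  choose Y hY c hc hYc using hg
  have hα (i : Fin m) : (fun q ↦ -α q i) ∈ functions E r U := ContMDiffOn.neg (hfb.alpha_cr i)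
  refine ⟨_, add_mem_sections hr hU (hf X hX) (sum_smul_mem_sections hr hU hα hY),
    fun j q ↦ dirDeriv X (fun q ↦ α q j) q - ∑ i, α q i * c i j q, fun j ↦ ?_, fun q hq ↦ ?_⟩
  · exact ContMDiffOn.sub (dirDeriv_mem_functions hr hU hX (hfb.alpha_cr j))
      (contMDiffOn_finsetSum fun i _ ↦ ContMDiffOn.mul (hfb.alpha_cr i) (hc i j))
  · have h₁ := mlieBracket_sum_smul_left hr (c := fun j q ↦ α q j) (g := S.g) X
      (fun j ↦ (hfb.alpha_cr j).contMDiffAt (hU.mem_nhds hq)) (fun j ↦ S.isCrAt_g j q)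
    have h₂ : IsCrAt r (fun q ↦ ∑ j, α q j • S.g j q) q :=
      isCrAt_sum_smul hr (fun j ↦ (hfb.alpha_cr j).contMDiffAt (hU.mem_nhds hq))
        (fun j ↦ S.isCrAt_g j q)
    have h₃ := VectorField.mlieBracket_add_left (W := X)
      ((S.isCrAt_f q).mdifferentiableAt hr0) (h₂.mdifferentiableAt hr0)
    have h₄ : VectorField.mlieBracket 𝓘(ℝ, E) (S.feedbackDrift α) X q =
      VectorField.mlieBracket 𝓘(ℝ, E) S.f X q +
        (∑ i, α q i • VectorField.mlieBracket 𝓘(ℝ, E) (S.g i) X q -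
          ∑ i, dirDeriv X (fun q ↦ α q i) q • S.g i q) := by
      rw [← h₁]; exact h₃
    rw [h₄]
    simp only [fun i ↦ hYc i q hq, smul_add, Finset.sum_add_distrib, Finset.smul_sum, smul_smul,
      sub_smul, Finset.sum_sub_distrib, neg_smul, Finset.sum_neg_distrib, Finset.sum_smul]
    rw [Finset.sum_comm (f := fun i j ↦ (α q i * c i j q) • S.g j q)]
    abel

end Necessity

/-! ### From the bracket conditions to a feedback -/

section Sufficiency

variable {E : Type*} [NormedAddCommGroup E] [NormedSpace ℝ E]
  {M : Type*} [TopologicalSpace M] [ChartedSpace E M] [IsManifold 𝓘(ℝ, E) ∞ M]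
  {r : ℕ∞ω} {D : GenDistribution E M} {p : M} {k l : ℕ}
  {θ : M → (Fin k → ℝ) × (Fin l → ℝ)} {θi : (Fin k → ℝ) × (Fin l → ℝ) → M}

theorem eventually_snd_dirDeriv_eq_zero {U : Set M} (hU : IsOpen U)
    (hD : ∀ᶠ q in 𝓝 p, ∀ w, w ∈ D q ↔ (mvfderiv 𝓘(ℝ, E) θ q w).2 = 0) {X : VField E M}
    (hX : X ∈ sections r U D) (hp : p ∈ U) : ∀ᶠ q in 𝓝 p, (dirDeriv X θ q).2 = 0 := by
  filter_upwards [hD, hU.mem_nhds hp] with q h₁ h₂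
  exact (h₁ _).1 (hX.2 q h₂)

variable [IsManifold 𝓘(ℝ, E) r M]

theorem eventually_contMDiffAt_dirDeriv (hr : r = ∞ ∨ r = ω) (hθ : IsLocalCoord (E := E) r p θ θi)
    {Z : VField E M} (hZ : ∀ᶠ q in 𝓝 p, IsCrAt r Z q) (c : Fin l) :
    ∀ᶠ q in 𝓝 p, ContMDiffAt 𝓘(ℝ, E) 𝓘(ℝ, ℝ) r (fun q ↦ (dirDeriv Z θ q).2 c) q := by
  filter_upwards [hZ, hθ.contMDiffAt] with q h₁ h₂
  let L : (Fin k → ℝ) × (Fin l → ℝ) →L[ℝ] ℝ :=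
    (ContinuousLinearMap.proj (R := ℝ) (φ := fun _ : Fin l ↦ ℝ) c).comp
      (ContinuousLinearMap.snd ℝ _ _)
  exact L.contMDiff.contMDiffAt.comp q (contMDiffAt_dirDeriv hr h₁ h₂)

variable [CompleteSpace E]

theorem snd_dirDeriv_mlieBracket_apply (hr : r = ∞ ∨ r = ω) {Z X : VField E M} {q : M}
    (hθ : ∀ᶠ q' in 𝓝 q, ContMDiffAt 𝓘(ℝ, E) 𝓘(ℝ, (Fin k → ℝ) × (Fin l → ℝ)) r θ q')
    (hZ : IsCrAt r Z q) (hX : IsCrAt r X q) (hker : ∀ᶠ q' in 𝓝 q, (dirDeriv X θ q').2 = 0)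
    (c : Fin l) :
    (dirDeriv (VectorField.mlieBracket 𝓘(ℝ, E) Z X) θ q).2 c =
      -dirDeriv X (fun q ↦ (dirDeriv Z θ q).2 c) q := by
  have hr0 : r ≠ 0 := by rcases hr with rfl | rfl <;> simp
  have h := dirDeriv_clm_comp (X := X) ((ContinuousLinearMap.proj (R := ℝ)
    (φ := fun _ : Fin l ↦ ℝ) c).comp (ContinuousLinearMap.snd ℝ (Fin k → ℝ) _))
    ((contMDiffAt_dirDeriv hr hZ hθ.self_of_nhds).mdifferentiableAt hr0)
  rw [snd_dirDeriv_mlieBracket hr hθ hZ hX hker]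
  exact congrArg Neg.neg h.symm

/-- A vector field whose transverse components do not depend on the leaf coordinate leaves the
distribution invariant. -/
theorem eventually_mlieBracket_mem (hr : r = ∞ ∨ r = ω) (hθ : IsLocalCoord (E := E) r p θ θi)
    (hD : ∀ᶠ q in 𝓝 p, ∀ w, w ∈ D q ↔ (mvfderiv 𝓘(ℝ, E) θ q w).2 = 0)
    {Z : VField E M} (hZ : ∀ᶠ q in 𝓝 p, IsCrAt r Z q)
    {h : Fin l → (Fin k → ℝ) × (Fin l → ℝ) → ℝ}
    (hh : ∀ c, ∀ᶠ z in 𝓝 0, DifferentiableAt ℝ (h c) z ∧ ∀ v, fderiv ℝ (h c) z (v, 0) = 0)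
    (hZh : ∀ c, ∀ᶠ q in 𝓝 p, (dirDeriv Z θ q).2 c = h c (θ q)) :
    ∀ᶠ q in 𝓝 p, ∀ U : Set M, IsOpen U → q ∈ U → ∀ X ∈ sections r U D,
      VectorField.mlieBracket 𝓘(ℝ, E) Z X q ∈ D q := by
  have hr0 : r ≠ 0 := by rcases hr with rfl | rfl <;> simp
  filter_upwards [hθ.contMDiffAt.eventually_nhds, hD.eventually_nhds, hZ,
    hθ.tendsto.eventually (Filter.eventually_all.2 hh),
    (Filter.eventually_all.2 hZh).eventually_nhds] with q h₁ h₂ h₃ h₄ h₅ U hU hq X hX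
  have hker := eventually_snd_dirDeriv_eq_zero hU h₂ hX hq
  refine (h₂.self_of_nhds _).2 (funext fun c ↦ ?_)
  have h₆ : (fun q ↦ (dirDeriv Z θ q).2 c) =ᶠ[𝓝 q] fun q ↦ h c (θ q) := h₅.mono fun q hq ↦ hq c
  refine (snd_dirDeriv_mlieBracket_apply hr h₁ h₃ (isCrAt_of_mem_sections hU hX hq) hker c).trans ?_
  rw [dirDeriv_congr h₆, dirDeriv_comp (h₄ c).1 (h₁.self_of_nhds.mdifferentiableAt hr0)]
  have h₇ : dirDeriv X θ q = ((dirDeriv X θ q).1, 0) := Prod.ext rfl hker.self_of_nhds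
  rw [h₇, (h₄ c).2, neg_zero]
  rfl

/-- The bracket condition on `Z` says that the derivatives of the transverse components of `Z` in
the direction of the leaves are linear in those of the `g_j`. -/
theorem eventually_fderiv_transverse (hr : r = ∞ ∨ r = ω) (hθ : IsLocalCoord (E := E) r p θ θi)
    (hD : ∀ᶠ q in 𝓝 p, ∀ w, w ∈ D q ↔ (mvfderiv 𝓘(ℝ, E) θ q w).2 = 0)
    {U : Set M} (hU : IsOpen U) (hp : p ∈ U) {X Y : Fin k → VField E M}
    (hX : ∀ a, X a ∈ sections r U D) (hY : ∀ a, Y a ∈ sections r U D)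
    {σ : (Fin k → ℝ) × (Fin l → ℝ) → (Fin k → ℝ) →L[ℝ] (Fin k → ℝ)}
    (hσ : ∀ᶠ q in 𝓝 p, ∀ v, ∑ i, σ (θ q) v i • dirDeriv (X i) θ q = (v, 0))
    {Z : VField E M} (hZ : ∀ᶠ q in 𝓝 p, IsCrAt r Z q) {m : ℕ} {g : Fin m → VField E M}
    {d : Fin k → Fin m → M → ℝ}
    (hZX : ∀ a, ∀ q ∈ U, VectorField.mlieBracket 𝓘(ℝ, E) Z (X a) q =
      Y a q + ∑ j, d a j q • g j q) (c : Fin l) :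
    ∀ᶠ z in 𝓝 0, ∀ v, fderiv ℝ (fun z ↦ (dirDeriv Z θ (θi z)).2 c) z (v, 0) =
      -∑ a, σ z v a * ∑ j, d a j (θi z) * (dirDeriv (g j) θ (θi z)).2 c := by
  have hr0 : r ≠ 0 := by rcases hr with rfl | rfl <;> simp
  let ψ : (Fin k → ℝ) × (Fin l → ℝ) → ℝ := fun z ↦ (dirDeriv Z θ (θi z)).2 c
  have hψ : ∀ᶠ z in 𝓝 0, ContDiffAt ℝ r ψ z :=
    hθ.eventually_contDiffAt_comp_inv (eventually_contMDiffAt_dirDeriv hr hθ hZ c)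
  have key : ∀ᶠ q in 𝓝 p, ∀ v, fderiv ℝ ψ (θ q) (v, 0) =
      -∑ a, σ (θ q) v a * ∑ j, d a j q * (dirDeriv (g j) θ q).2 c := by
    filter_upwards [hθ.contMDiffAt.eventually_nhds, hD.eventually_nhds, hZ, hσ,
      hθ.left_inv.eventually_nhds, hU.mem_nhds hp, hθ.tendsto.eventually hψ]
      with q h₁ h₂ h₃ h₄ h₅ hq h₆ v
    have h₇ : (fun q ↦ (dirDeriv Z θ q).2 c) =ᶠ[𝓝 q] fun q ↦ ψ (θ q) :=
      h₅.mono fun q hq ↦ by simp only [ψ, hq]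
    have h₈ (a : Fin k) : fderiv ℝ ψ (θ q) (dirDeriv (X a) θ q) =
        -∑ j, d a j q * (dirDeriv (g j) θ q).2 c := by
      have h₉ := snd_dirDeriv_mlieBracket_apply hr h₁ h₃
        (isCrAt_of_mem_sections hU (hX a) hq) (eventually_snd_dirDeriv_eq_zero hU h₂ (hX a) hq) c
      rw [dirDeriv_congr h₇, dirDeriv_comp (h₆.differentiableAt hr0)
        (h₁.self_of_nhds.mdifferentiableAt hr0)] at h₉
      rw [← neg_eq_iff_eq_neg, ← h₉]
      have h₁₀ : dirDeriv (VectorField.mlieBracket 𝓘(ℝ, E) Z (X a)) θ q =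
          dirDeriv (Y a) θ q + ∑ j, d a j q • dirDeriv (g j) θ q := by
        have h₁₁ : dirDeriv (VectorField.mlieBracket 𝓘(ℝ, E) Z (X a)) θ q =
            dirDeriv (fun q ↦ Y a q + ∑ j, d a j q • g j q) θ q := by
          simp only [dirDeriv, hZX a q hq]
        rw [h₁₁]
        refine (dirDeriv_add (Y a) (fun q ↦ ∑ j, d a j q • g j q) θ q).trans ?_
        rw [dirDeriv_sum_smul]
      rw [h₁₀, Prod.snd_add, (eventually_snd_dirDeriv_eq_zero hU h₂ (hY a) hq).self_of_nhds,
        zero_add, Prod.snd_sum, Finset.sum_apply]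
      rfl
    rw [← h₄ v, map_sum, ← Finset.sum_neg_distrib]
    refine Finset.sum_congr rfl fun a _ ↦ ?_
    rw [map_smul, h₈, smul_eq_mul, mul_neg]
  filter_upwards [hθ.tendsto_inv.eventually key, hθ.right_inv] with z h₁ h₂
  rwa [h₂] at h₁

/-- The transverse components of the fields `f, g_1, …, g_m`, in coordinates, as a family of
elements of `ℝ × ℝ^m`. -/
noncomputable def AffineSystem.transverse {m : ℕ} (S : AffineSystem E M r m)
    (θ : M → (Fin k → ℝ) × (Fin l → ℝ)) (θi : (Fin k → ℝ) × (Fin l → ℝ) → M) (c : Fin l)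
    (z : (Fin k → ℝ) × (Fin l → ℝ)) : ℝ × (Fin m → ℝ) :=
  ((dirDeriv S.f θ (θi z)).2 c, fun i ↦ (dirDeriv (S.g i) θ (θi z)).2 c)

/-- The linear map of `ℝ × ℝ^m` which sends `(a, y)` to `(∑ d_j y_j, c y)`. -/
noncomputable def couplingMap {m : ℕ} (d : Fin m → ℝ) (c : Fin m → Fin m → ℝ) :
    ℝ × (Fin m → ℝ) →L[ℝ] ℝ × (Fin m → ℝ) :=
  ∑ j, (d j • (ContinuousLinearMap.inl ℝ ℝ (Fin m → ℝ)).comp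
      ((ContinuousLinearMap.proj (R := ℝ) (φ := fun _ : Fin m ↦ ℝ) j).comp
        (ContinuousLinearMap.snd ℝ ℝ (Fin m → ℝ))) +
    ∑ i, c i j • ((ContinuousLinearMap.inr ℝ ℝ (Fin m → ℝ)).comp
      (ContinuousLinearMap.single ℝ (fun _ : Fin m ↦ ℝ) i)).comp
      ((ContinuousLinearMap.proj (R := ℝ) (φ := fun _ : Fin m ↦ ℝ) j).comp
        (ContinuousLinearMap.snd ℝ ℝ (Fin m → ℝ))))

theorem couplingMap_apply {m : ℕ} (d : Fin m → ℝ) (c : Fin m → Fin m → ℝ) (a : ℝ)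
    (y : Fin m → ℝ) :
    couplingMap d c (a, y) = (∑ j, d j * y j, fun i ↦ ∑ j, c i j * y j) := by
  simp only [couplingMap, sum_apply, add_apply,
    smul_apply, ContinuousLinearMap.comp_apply, ContinuousLinearMap.coe_snd',
    ContinuousLinearMap.proj_apply, ContinuousLinearMap.inl_apply, ContinuousLinearMap.inr_apply]
  ext i
  · simp [Prod.fst_sum]
  · simp [Prod.snd_sum, Finset.sum_apply, Pi.single_apply]

theorem contDiffAt_couplingMap {V : Type*} [NormedAddCommGroup V] [NormedSpace ℝ V] {r : ℕ∞ω}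
    {m : ℕ} {d : V → Fin m → ℝ} {c : V → Fin m → Fin m → ℝ} {z : V}
    (hd : ∀ j, ContDiffAt ℝ r (fun z ↦ d z j) z) (hc : ∀ i j, ContDiffAt ℝ r (fun z ↦ c z i j) z) :
    ContDiffAt ℝ r (fun z ↦ couplingMap (d z) (c z)) z := by
  unfold couplingMap
  exact ContDiffAt.sum fun j _ ↦ ((hd j).smul contDiffAt_const).add
    (ContDiffAt.sum fun i _ ↦ (hc i j).smul contDiffAt_const)

/-- Under the bracket conditions there is, near `p`, a gauge transformation `B` of the trivial
bundle with fibre `ℝ × ℝ^m` that fixes `(1, 0)` and makes the transverse components of the system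
independent of the leaf coordinate. -/
theorem exists_transverse_gauge (hr : r = ∞ ∨ r = ω) (hθ : IsLocalCoord (E := E) r p θ θi)
    (hD : ∀ᶠ q in 𝓝 p, ∀ w, w ∈ D q ↔ (mvfderiv 𝓘(ℝ, E) θ q w).2 = 0)
    {U : Set M} (hU : IsOpen U) (hp : p ∈ U) {X : Fin k → VField E M}
    (hX : ∀ a, X a ∈ sections r U D)
    {σ : (Fin k → ℝ) × (Fin l → ℝ) → (Fin k → ℝ) →L[ℝ] (Fin k → ℝ)}
    (hσc : ∀ᶠ z in 𝓝 0, ContDiffAt ℝ r σ z)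
    (hσ : ∀ᶠ q in 𝓝 p, ∀ v, ∑ i, σ (θ q) v i • dirDeriv (X i) θ q = (v, 0))
    {m : ℕ} (S : AffineSystem E M r m)
    (hg : ∀ i, ∀ a, VectorField.mlieBracket 𝓘(ℝ, E) (S.g i) (X a) ∈ sectionsAddSpan r U D S.g)
    (hf : ∀ a, VectorField.mlieBracket 𝓘(ℝ, E) S.f (X a) ∈ sectionsAddSpan r U D S.g) :
    ∃ B : (Fin k → ℝ) × (Fin l → ℝ) → ℝ × (Fin m → ℝ) →L[ℝ] ℝ × (Fin m → ℝ),
      (∀ᶠ z in 𝓝 0, ContDiffAt ℝ r B z) ∧ B 0 = ContinuousLinearMap.id ℝ _ ∧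
      (∀ᶠ z in 𝓝 0, B z (1, 0) = (1, 0)) ∧
      ∀ c, ∀ᶠ z in 𝓝 0, DifferentiableAt ℝ (fun z ↦ B z (S.transverse θ θi c z)) z ∧
        ∀ v, fderiv ℝ (fun z ↦ B z (S.transverse θ θi c z)) z (v, 0) = 0 := by
  have hr0 : r ≠ 0 := by rcases hr with rfl | rfl <;> simp
  choose Y hY e he hYe using hg
  choose Y₀ hY₀ d hd hYd using hf
  have hcoeff {φ : M → ℝ} (hφ : φ ∈ functions E r U) :
      ∀ᶠ z in 𝓝 0, ContDiffAt ℝ r (fun z ↦ φ (θi z)) z :=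
    hθ.eventually_contDiffAt_comp_inv <| by
      filter_upwards [hU.mem_nhds hp] with q hq using hφ.contMDiffAt (hU.mem_nhds hq)
  let C : (Fin k → ℝ) × (Fin l → ℝ) →
      (Fin k → ℝ) →L[ℝ] (ℝ × (Fin m → ℝ)) →L[ℝ] (ℝ × (Fin m → ℝ)) := fun z ↦
    ∑ a, ((ContinuousLinearMap.proj (R := ℝ) (φ := fun _ : Fin k ↦ ℝ) a).comp (σ z)).smulRight
      (couplingMap (fun j ↦ d a j (θi z)) (fun i j ↦ e i a j (θi z)))
  have hC (z v w) : C z v w = ∑ a, σ z v a •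
      couplingMap (fun j ↦ d a j (θi z)) (fun i j ↦ e i a j (θi z)) w := by
    simp [C]
  have hCc : ∀ᶠ z in 𝓝 0, ContDiffAt ℝ r C z := by
    filter_upwards [hσc, Filter.eventually_all.2 fun a ↦ Filter.eventually_all.2 fun j ↦
      hcoeff (hd a j), Filter.eventually_all.2 fun i ↦ Filter.eventually_all.2 fun a ↦
      Filter.eventually_all.2 fun j ↦ hcoeff (he i a j)] with z h₁ h₂ h₃
    exact ContDiffAt.sum fun a _ ↦ (contDiffAt_const.clm_comp h₁).smulRight
      (contDiffAt_couplingMap (h₂ a) fun i j ↦ h₃ i a j)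
  obtain ⟨B, hBc, hB0, hBfix, hBn⟩ := exists_radial_gauge hr hCc
  have hZ (Z : VField E M) (hZ : ∀ q, IsCrAt r Z q) (c : Fin l) :
      ∀ᶠ z in 𝓝 0, DifferentiableAt ℝ (fun z ↦ (dirDeriv Z θ (θi z)).2 c) z :=
    (hθ.eventually_contDiffAt_comp_inv (eventually_contMDiffAt_dirDeriv hr hθ (.of_forall hZ) c)).mono
      fun z hz ↦ hz.differentiableAt hr0
  have hn (c : Fin l) : ∀ᶠ z in 𝓝 0, DifferentiableAt ℝ (S.transverse θ θi c) z := by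
    filter_upwards [hZ S.f S.isCrAt_f c, Filter.eventually_all.2 fun i ↦
      hZ (S.g i) (S.isCrAt_g i) c] with z h₁ h₂
    exact h₁.prodMk (differentiableAt_pi.2 h₂)
  refine ⟨B, hBc, hB0, hBfix _ (.of_forall fun z v ↦ ?_), fun c ↦ ?_⟩
  · rw [hC]
    refine Finset.sum_eq_zero fun a _ ↦ ?_
    have h₁ : couplingMap (fun j ↦ d a j (θi z)) (fun i j ↦ e i a j (θi z)) (1, 0) = 0 := by
      rw [couplingMap_apply]
      ext <;> simp
    rw [h₁, smul_zero]
  · refine Filter.Eventually.and ?_ (hBn _ (hn c) ?_)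
    · filter_upwards [hBc, hn c] with z h₁ h₂
      exact (h₁.differentiableAt hr0).clm_apply h₂
    · filter_upwards [eventually_fderiv_transverse hr hθ hD hU hp hX hY₀ hσ
        (.of_forall S.isCrAt_f) hYd c, Filter.eventually_all.2 fun i ↦
        eventually_fderiv_transverse hr hθ hD hU hp hX (hY i) hσ
        (.of_forall (S.isCrAt_g i)) (hYe i) c, hZ S.f S.isCrAt_f c, Filter.eventually_all.2 fun i ↦
        hZ (S.g i) (S.isCrAt_g i) c] with z h₁ h₂ h₃ h₄ v
      have h₅ : HasFDerivAt (S.transverse θ θi c) _ z :=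
        h₃.hasFDerivAt.prodMk (hasFDerivAt_pi.2 fun i ↦ (h₄ i).hasFDerivAt)
      rw [h₅.fderiv, hC]
      simp only [AffineSystem.transverse, couplingMap_apply]
      ext i
      · simp [h₁ v, Prod.fst_sum]
      · simp [h₂ i v, Prod.snd_sum, Finset.sum_apply]

/-- The bracket conditions imply local controlled invariance: the matrix entries of the gauge
transformation on `0 × ℝ^m` are the feedback functions. -/
theorem isLocallyControlledInvariantAt_of_mlieBracket_mem [FiniteDimensional ℝ E]
    (hr : r = ∞ ∨ r = ω) {m : ℕ} (S : AffineSystem E M r m) (hreg : IsRegularDistribution r D)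
    (hinv : IsInvolutive r D) {U : Set M} (hU : IsSmallNhd r D p U)
    (hg : ∀ i, ∀ X ∈ sections r U D,
      VectorField.mlieBracket 𝓘(ℝ, E) (S.g i) X ∈ sectionsAddSpan r U D S.g)
    (hf : ∀ X ∈ sections r U D,
      VectorField.mlieBracket 𝓘(ℝ, E) S.f X ∈ sectionsAddSpan r U D S.g) :
    IsLocallyControlledInvariantAt D S p := by
  obtain ⟨k, l, X, θ, θi, σ, hX, hθ, hσc, hD, hσ⟩ := exists_adapted_coordinates hr hreg hinv hU
  obtain ⟨B, hBc, hB0, hBfix, hBn⟩ := exists_transverse_gauge hr hθ hD hU.isOpen hU.mem hX hσc hσ S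
    (fun i a ↦ hg i _ (hX a)) (fun a ↦ hf _ (hX a))
  let b : Fin m → M → ℝ × (Fin m → ℝ) := fun j q ↦ B (θ q) (0, Pi.single j 1)
  let α : M → Fin m → ℝ := fun q j ↦ (b j q).1
  let β : M → Matrix (Fin m) (Fin m) ℝ := fun q ↦ Matrix.of fun i j ↦ (b j q).2 i
  have hb : ∀ᶠ q in 𝓝 p, ∀ j, ContMDiffAt 𝓘(ℝ, E) 𝓘(ℝ, ℝ × (Fin m → ℝ)) r (b j) q :=
    Filter.eventually_all.2 fun j ↦ hθ.eventually_contMDiffAt_comp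
      (g := fun z ↦ B z (0, Pi.single j 1)) <| hBc.mono fun z hz ↦ hz.clm_apply contDiffAt_const
  have hα : ∀ᶠ q in 𝓝 p, ∀ j, ContMDiffAt 𝓘(ℝ, E) 𝓘(ℝ, ℝ) r (fun q ↦ α q j) q :=
    hb.mono fun q hq j ↦
      (ContinuousLinearMap.fst ℝ ℝ (Fin m → ℝ)).contMDiff.contMDiffAt.comp q (hq j)
  have hβ : ∀ᶠ q in 𝓝 p, ∀ i j, ContMDiffAt 𝓘(ℝ, E) 𝓘(ℝ, ℝ) r (fun q ↦ β q i j) q :=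
    hb.mono fun q hq i j ↦ ((ContinuousLinearMap.proj (R := ℝ) (φ := fun _ : Fin m ↦ ℝ) i).comp
      (ContinuousLinearMap.snd ℝ ℝ (Fin m → ℝ))).contMDiff.contMDiffAt.comp q (hq j)
  -- at `p` the gauge transformation is the identity, so `β` is invertible nearby
  have hβu : ∀ᶠ q in 𝓝 p, IsUnit (β q) := by
    have h₁ : ContinuousAt (fun q ↦ (β q).det) p := by
      have h₂ : ContinuousAt β p := continuousAt_pi.2 fun i ↦ continuousAt_pi.2 fun j ↦
        (hβ.self_of_nhds i j).continuousAt
      exact (Continuous.matrix_det continuous_id).continuousAt.comp h₂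
    have h₂ : β p = 1 := by
      ext i j
      simp [β, b, hθ.map_base, hB0, Matrix.one_apply, Pi.single_apply]
    have h₃ : (β p).det ≠ 0 := by simp [h₂]
    filter_upwards [h₁.eventually_ne h₃] with q hq
    exact (Matrix.isUnit_iff_isUnit_det _).2 (isUnit_iff_ne_zero.2 hq)
  have hBapp : ∀ᶠ q in 𝓝 p, ∀ (a : ℝ) (y : Fin m → ℝ),
      B (θ q) (a, y) = (a, 0) + ∑ j, y j • b j q := by
    filter_upwards [hθ.tendsto.eventually hBfix] with q hq a y
    have h₁ : ((a, y) : ℝ × (Fin m → ℝ)) =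
        a • (1, 0) + ∑ j, y j • (0, Pi.single j 1) := by
      ext i
      · simp [Prod.fst_sum]
      · simp [Prod.snd_sum, Finset.sum_apply, Pi.single_apply]
    rw [h₁, map_add, map_smul, hq, map_sum]
    congr 1
    · simp
    · exact Finset.sum_congr rfl fun j _ ↦ map_smul _ _ _
  -- the transverse components of the system obtained by feedback
  have hfθ (c : Fin l) : ∀ᶠ q in 𝓝 p, (dirDeriv (S.feedbackDrift α) θ q).2 c =
      (B (θ q) (S.transverse θ θi c (θ q))).1 := by
    filter_upwards [hBapp, hθ.left_inv] with q hq hl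
    have h₁ : dirDeriv (S.feedbackDrift α) θ q =
        dirDeriv S.f θ q + ∑ i, α q i • dirDeriv (S.g i) θ q :=
      (dirDeriv_add S.f (fun q ↦ ∑ i, α q i • S.g i q) θ q).trans
        (congrArg _ (dirDeriv_sum_smul (fun i q ↦ α q i) S.g θ q))
    rw [h₁, AffineSystem.transverse, hq, hl]
    simp [Prod.fst_sum, Prod.snd_sum, Finset.sum_apply, α, mul_comm]
  have hgθ (i : Fin m) (c : Fin l) : ∀ᶠ q in 𝓝 p, (dirDeriv (S.feedbackControl β i) θ q).2 c =
      (B (θ q) (S.transverse θ θi c (θ q))).2 i := by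
    filter_upwards [hBapp, hθ.left_inv] with q hq hl
    have h₁ : dirDeriv (S.feedbackControl β i) θ q = ∑ j, β q i j • dirDeriv (S.g j) θ q :=
      dirDeriv_sum_smul (fun j q ↦ β q i j) S.g θ q
    rw [h₁, AffineSystem.transverse, hq, hl]
    simp [Prod.snd_sum, Finset.sum_apply, β, mul_comm]
  have hfc : ∀ᶠ q in 𝓝 p, IsCrAt r (S.feedbackDrift α) q := hα.mono fun q hq ↦
    isCrAt_add hr (S.isCrAt_f q) (isCrAt_sum_smul hr hq fun i ↦ S.isCrAt_g i q)
  have hgc (i : Fin m) : ∀ᶠ q in 𝓝 p, IsCrAt r (S.feedbackControl β i) q := hβ.mono fun q hq ↦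
    isCrAt_sum_smul hr (hq i) fun j ↦ S.isCrAt_g j q
  have hcomp (L : ℝ × (Fin m → ℝ) →L[ℝ] ℝ) (c : Fin l) : ∀ᶠ z in 𝓝 0,
      DifferentiableAt ℝ (fun z ↦ L (B z (S.transverse θ θi c z))) z ∧
        ∀ v, fderiv ℝ (fun z ↦ L (B z (S.transverse θ θi c z))) z (v, 0) = 0 := by
    filter_upwards [hBn c] with z ⟨h₁, h₂⟩
    have h₃ := L.hasFDerivAt.comp z h₁.hasFDerivAt
    refine ⟨h₃.differentiableAt, fun v ↦ ?_⟩
    have h₄ := congrArg (fun A ↦ A (v, (0 : Fin l → ℝ))) h₃.fderiv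
    refine h₄.trans ?_
    rw [ContinuousLinearMap.comp_apply, h₂, map_zero]
  have hfD := eventually_mlieBracket_mem hr hθ hD hfc
    (hcomp (ContinuousLinearMap.fst ℝ ℝ (Fin m → ℝ))) hfθ
  have hgD (i : Fin m) := eventually_mlieBracket_mem hr hθ hD (hgc i)
    (hcomp ((ContinuousLinearMap.proj (R := ℝ) (φ := fun _ : Fin m ↦ ℝ) i).comp
      (ContinuousLinearMap.snd ℝ ℝ (Fin m → ℝ)))) (hgθ i)
  obtain ⟨W, hW, hWs⟩ := exists_isSmallNhd hr hreg p
  obtain ⟨U', hU', hU'o, hpU'⟩ := eventually_nhds_iff.1 <|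
    (Filter.Eventually.and (show ∀ᶠ q in 𝓝 p, q ∈ W from hW) <| hα.and <| hβ.and <| hβu.and <|
      hfc.and <| (Filter.eventually_all.2 hgc).and <| hfD.and <| Filter.eventually_all.2 hgD)
  refine ⟨U', hWs U' (fun q hq ↦ (hU' q hq).1) hU'o hpU', α, β, ⟨fun i q hq ↦ ?_, fun i j q hq ↦ ?_,
    fun q hq ↦ ?_⟩, fun Y hY ↦ ⟨fun q hq ↦ ?_, fun q hq ↦ ?_⟩,
    fun i Y hY ↦ ⟨fun q hq ↦ ?_, fun q hq ↦ ?_⟩⟩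
  all_goals obtain ⟨-, h₁, h₂, h₃, h₄, h₅, h₆, h₇⟩ := hU' q hq
  · exact (h₁ i).contMDiffWithinAt
  · exact (h₂ i j).contMDiffWithinAt
  · exact h₃
  · exact (isCrAt_mlieBracket hr h₄ (isCrAt_of_mem_sections hU'o hY hq)).contMDiffWithinAt
  · exact h₆ U' hU'o hq Y hY
  · exact (isCrAt_mlieBracket hr (h₅ i) (isCrAt_of_mem_sections hU'o hY hq)).contMDiffWithinAt
  · exact h₇ i U' hU'o hq Y hY

end Sufficiency
end ControlledInvariance

/-- Local controlled invariance of an involutive regular `C^r` distribution, `r = ∞` or `r = ω`.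
(The instance `IsManifold 𝓘(ℝ, E) ∞ M` follows from the `C^r` one; it makes the tangent bundle
available to type class search.) -/
theorem mainTheorem1 {E : Type*} [NormedAddCommGroup E] [NormedSpace ℝ E] [FiniteDimensional ℝ E]
    {M : Type*} [TopologicalSpace M] [ChartedSpace E M] [T2Space M] [ParacompactSpace M]
    (r : ℕ∞ω) (hr : r = ∞ ∨ r = ω) [IsManifold 𝓘(ℝ, E) ∞ M] [IsManifold 𝓘(ℝ, E) r M]
    {m : ℕ} (S : AffineSystem E M r m) (D : GenDistribution E M)
    (hreg : IsRegularDistribution r D) (hinv : IsInvolutive r D) (p : M) :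
    IsLocallyControlledInvariantAt D S p ↔
      ∃ U : Set M, IsSmallNhd r D p U ∧
        (∀ i, ∀ X ∈ sections r U D,
          VectorField.mlieBracket 𝓘(ℝ, E) (S.g i) X ∈ sectionsAddSpan r U D S.g) ∧
        ∀ X ∈ sections r U D,
          VectorField.mlieBracket 𝓘(ℝ, E) S.f X ∈ sectionsAddSpan r U D S.g := by
  have : CompleteSpace E := FiniteDimensional.complete ℝ E
  constructor
  · rintro ⟨U, hU, α, β, hfb, hf, hg⟩
    have hgU := fun i X (hX : X ∈ sections r U D) ↦ mlieBracket_g_mem hr hU.isOpen hfb hg hX i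
    exact ⟨U, hU, hgU, fun X hX ↦ mlieBracket_f_mem hr hU.isOpen hfb hf hX fun i ↦ hgU i X hX⟩
  · rintro ⟨U, hU, hg, hf⟩
    exact isLocallyControlledInvariantAt_of_mlieBracket_mem hr S hreg hinv hU hg hf
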